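/- Let $E$ be a Polish space, $(X_k)_{k\ge 0}$ a time-homogeneous Markov chain on $E$ with an arbitrary transition kernel and an arbitrary initial law, $\xi:E\to\mathbb{R}$ continuous, $z_B\in\mathbb{R}$, $A\subset E$ a measurable set with $\xi\le z_B$ on $A$, $\mathcal{T}\subset\mathbb{N}$ a set of memory times, and $n_{\rm rep}\ge 2$ an integer. For a path $x=(x_k)_{k\ge0}$ put $t_z(x)=\inf\{k\ge 0:\xi(x_k)>z\}$ and $\tau_A(x)=\inf\{k\ge0: x_k\in A\}$ (with $\inf\emptyset=\infty$). The Adaptive Multilevel Splitting algorithm runs as follows. Start from $n_{\rm rep}$ independent copies (replicas) of the chain, each stopped at time $\min(\tau_A,t_{z_B})$. As long as some replica has not exceeded the level $z_B$, perform an iteration: 1. Compute the maximal level $\sup_{k\ge0}\xi(x_k)$ of each (stopped) replica $x$, and let $M$ be the smallest of these maximal levels. The killed replica is the one with maximal level $M$; if there are several, it is the one with the smallest index. 2. Choose a replica $x$ uniformly among the $n_{\rm rep}-1$ other ones, independently of the past, and let $\tau=\inf\{k\in\mathcal{T}: k\ge t_M(x)\}$. 3. Replace the killed replica by the path that follows $x$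 up to time $\tau$ and then evolves, independently of everything else, as the Markov chain started from $x_\tau$, stopped when it enters $A$ or exceeds the level $z_B$ (so it is a full copy of $x$ if $\tau=\infty$ or if $x$ is already stopped at time $\tau$). Let $Q_{\rm iter}\in\{0,1,2,\dots\}\cup\{\infty\}$ be the number of iterations performed until all the replicas have exceeded the level $z_B$, and put $(1-1/n_{\rm rep})^{\infty}=0$. Then $(1-1/n_{\rm rep})^{Q_{\rm iter}}$ is integrable and $$\mathbb{E}\left[\left(1-\frac1{n_{\rm rep}}\right)^{Q_{\rm iter}}\right]=\mathbb{P}\left(t_{z_B}(X)<\tau_A(X)\right).$$ No assumption that independent copies of the chain have almost surely distinct maximal levels is needed; in particular the identity holds under such an assumption. -/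

import Mathlib

open MeasureTheory ProbabilityTheory

noncomputable section

namespace AMS

/-! ### Times and paths -/

/-- The first index `k` for which `P k` holds, `⊤` if there is none (the infimum in `ℕ∞`). -/
def firstTime (P : ℕ → Prop) : ℕ∞ := ⨅ (k : ℕ) (_ : P k), (k : ℕ∞)

lemma firstTime_le_iff (P : ℕ → Prop) (m : ℕ) : firstTime P ≤ m ↔ ∃ k ≤ m, P k := by
  constructor
  · intro h
    by_contra! hc
    have h1 : ((m + 1 : ℕ) : ℕ∞) ≤ firstTime P := by
      refine le_iInf₂ fun k hk => ?_
      have : ¬ k ≤ m := fun hkm => hc k hkm hk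
      exact_mod_cast (by omega : m + 1 ≤ k)
    have h2 := h1.trans h
    have h3 : m + 1 ≤ m := by exact_mod_cast h2
    omega
  · rintro ⟨k, hk, hP⟩
    exact (iInf₂_le k hP).trans (by exact_mod_cast hk)

lemma measurable_enat_of_le {Ω : Type*} [MeasurableSpace Ω] {f : Ω → ℕ∞}
    (h : ∀ m : ℕ, MeasurableSet {ω | f ω ≤ m}) : Measurable f := by
  have hfin : ∀ m : ℕ, MeasurableSet (f ⁻¹' {(m : ℕ∞)}) := by
    intro m
    have : f ⁻¹' {(m : ℕ∞)} = {ω | f ω ≤ m} \ ⋃ j : ℕ, ⋃ _ : j < m, {ω | f ω ≤ j} := by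
      ext ω
      simp only [Set.mem_preimage, Set.mem_singleton_iff, Set.mem_sdiff, Set.mem_ofPred_eq,
        Set.mem_iUnion, not_exists]
      constructor
      · intro hω
        refine ⟨hω.le, fun j hj hle => ?_⟩
        rw [hω] at hle
        exact absurd (by exact_mod_cast hle : m ≤ j) (by omega)
      · rintro ⟨h1, h2⟩
        obtain ⟨j, hj⟩ := ENat.ne_top_iff_exists.mp (ne_top_of_le_ne_top (ENat.natCast_ne_top m) h1)
        rw [← hj] at h1 h2 ⊢
        have h1' : j ≤ m := by exact_mod_cast h1
        by_cases hjm : j < m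
        · exact absurd le_rfl (h2 j hjm)
        · have : j = m := by omega
          rw [this]
    rw [this]
    exact (h m).diff (MeasurableSet.iUnion fun j => MeasurableSet.iUnion fun _ => h j)
  refine measurable_to_countable' fun a => ?_
  induction a using ENat.recTopCoe with
  | coe m => exact hfin m
  | top =>
    have : f ⁻¹' {(⊤ : ℕ∞)} = (⋃ m : ℕ, f ⁻¹' {(m : ℕ∞)})ᶜ := by
      ext ω
      simp only [Set.mem_preimage, Set.mem_singleton_iff, Set.mem_compl_iff, Set.mem_iUnion,
        not_exists]
      constructor
      · intro hω m hm
        rw [hω] at hm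
        exact ENat.natCast_ne_top m hm.symm
      · intro hω
        by_contra hne
        obtain ⟨j, hj⟩ := ENat.ne_top_iff_exists.mp hne
        exact hω j hj.symm
    rw [this]
    exact (MeasurableSet.iUnion hfin).compl

lemma measurable_firstTime {Ω : Type*} [MeasurableSpace Ω] {P : Ω → ℕ → Prop}
    (hP : ∀ k, MeasurableSet {ω | P ω k}) : Measurable fun ω => firstTime (P ω) := by
  refine measurable_enat_of_le fun m => ?_
  have : {ω | firstTime (P ω) ≤ m} = ⋃ k : ℕ, ⋃ _ : k ≤ m, {ω | P ω k} := by
    ext ω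
    simp [firstTime_le_iff]
  rw [this]
  exact MeasurableSet.iUnion fun k => MeasurableSet.iUnion fun _ => hP k

/-- The path obtained by following `x` up to and including time `T`, and then `y`, whose clock is
started at time `T`. For `T = ⊤` this is `x`. -/
def splice {E : Type*} (T : ℕ∞) (x y : ℕ → E) : ℕ → E :=
  fun k => if (k : ℕ∞) ≤ T then x k else y (k - T.toNat)

/-- The path `x` stopped at time `T`. -/
def stopAt {E : Type*} (T : ℕ∞) (x : ℕ → E) : ℕ → E :=
  fun k => x (min (k : ℕ∞) T).toNat

/-- `t_z(x) = inf {k ≥ 0 | ξ(x_k) > z}`. -/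
def levelTime {E : Type*} (ξ : E → ℝ) (z : EReal) (x : ℕ → E) : ℕ∞ :=
  firstTime fun k => z < (ξ (x k) : EReal)

/-- `τ_A(x) = inf {k ≥ 0 | x_k ∈ A}`. -/
def hitTime {E : Type*} (A : Set E) (x : ℕ → E) : ℕ∞ := firstTime fun k => x k ∈ A

/-- The path `x` stopped at `min (τ_A(x), t_{z_B}(x))`. -/
def stopPath {E : Type*} (ξ : E → ℝ) (A : Set E) (zB : ℝ) (x : ℕ → E) : ℕ → E :=
  stopAt (min (hitTime A x) (levelTime ξ zB x)) x

/-- The maximal level of a path (a supremum, computed in the extended reals). -/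
def maxLevel {E : Type*} (ξ : E → ℝ) (x : ℕ → E) : EReal := ⨆ k, (ξ (x k) : EReal)

/-- The first memory time `k ∈ 𝒯` at which the path has already exceeded the level `z`. -/
def branchTime {E : Type*} (ξ : E → ℝ) (𝒯 : Set ℕ) (z : EReal) (x : ℕ → E) : ℕ∞ :=
  firstTime fun k => k ∈ 𝒯 ∧ levelTime ξ z x ≤ k

section Measurability

variable {E : Type*} [MeasurableSpace E] {ξ : E → ℝ} {A : Set E}

lemma measurable_levelTime (hξ : Measurable ξ) :
    Measurable fun p : EReal × (ℕ → E) => levelTime ξ p.1 p.2 :=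
  measurable_firstTime fun k => measurableSet_lt measurable_fst
    (hξ.comp ((measurable_pi_apply k).comp measurable_snd)).coe_real_ereal

lemma measurable_hitTime (hA : MeasurableSet A) : Measurable (hitTime A) :=
  measurable_firstTime fun k => measurable_pi_apply k hA

lemma measurable_maxLevel (hξ : Measurable ξ) : Measurable (maxLevel ξ) :=
  Measurable.iSup fun k => (hξ.comp (measurable_pi_apply k)).coe_real_ereal

lemma measurable_branchTime (hξ : Measurable ξ) (𝒯 : Set ℕ) :
    Measurable fun p : EReal × (ℕ → E) => branchTime ξ 𝒯 p.1 p.2 :=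
  measurable_firstTime fun k => by
    by_cases hk : k ∈ 𝒯
    · simp only [hk, true_and]
      exact measurable_levelTime hξ (MeasurableSet.of_discrete (s := {t : ℕ∞ | t ≤ k}))
    · simp [hk]

lemma measurable_eval : Measurable fun p : ℕ × (ℕ → E) => p.2 p.1 :=
  measurable_from_prod_countable_right fun k => measurable_pi_apply k

lemma measurable_splice :
    Measurable fun p : ℕ∞ × (ℕ → E) × (ℕ → E) => splice p.1 p.2.1 p.2.2 := by
  refine measurable_from_prod_countable_right fun T => measurable_pi_lambda _ fun k => ?_
  by_cases hk : (k : ℕ∞) ≤ T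
  · simp only [splice, hk, if_true]
    exact (measurable_pi_apply k).comp measurable_fst
  · simp only [splice, hk, if_false]
    exact (measurable_pi_apply _).comp measurable_snd

lemma measurable_stopAt : Measurable fun p : ℕ∞ × (ℕ → E) => stopAt p.1 p.2 :=
  measurable_from_prod_countable_right fun T =>
    measurable_pi_lambda _ fun k => measurable_pi_apply (min (k : ℕ∞) T).toNat

lemma measurable_stopPath (hξ : Measurable ξ) (hA : MeasurableSet A) (zB : ℝ) :
    Measurable (stopPath ξ A zB) := by
  have h1 : Measurable fun x : ℕ → E => levelTime ξ zB x :=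
    (measurable_levelTime hξ).comp (measurable_const.prodMk measurable_id)
  have h2 : Measurable fun x : ℕ → E => min (hitTime A x) (levelTime ξ zB x) :=
    (Measurable.of_discrete (f := fun t : ℕ∞ × ℕ∞ => min t.1 t.2)).comp
      ((measurable_hitTime hA).prodMk h1)
  exact measurable_stopAt.comp (h2.prodMk measurable_id)

end Measurability

/-! ### Homogeneous Markov chains -/

/-- For each `x`, the law on path space of the Markov chain with transition kernel `κ` and initial
condition `x`. -/
def chainKernel {E : Type*} [MeasurableSpace E] (κ : Kernel E E) [IsMarkovKernel κ] :
    Kernel E (ℕ → E) :=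
  (Kernel.traj (X := fun _ => E)
    (fun n => κ.comap (fun h : (i : Finset.Iic n) → E => h ⟨n, Finset.mem_Iic.2 le_rfl⟩)
      (measurable_pi_apply _)) 0).comap
    (fun x _ => x) (measurable_pi_lambda _ fun _ => measurable_id)

instance {E : Type*} [MeasurableSpace E] (κ : Kernel E E) [IsMarkovKernel κ] :
    IsMarkovKernel (chainKernel κ) := by
  unfold chainKernel
  infer_instance

/-- The law on path space of the Markov chain with transition kernel `κ` and initial law `μ`. -/
def chainLaw {E : Type*} [MeasurableSpace E] (κ : Kernel E E) [IsMarkovKernel κ]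
    (μ : Measure E) : Measure (ℕ → E) := μ.bind (chainKernel κ)

instance {E : Type*} [MeasurableSpace E] (κ : Kernel E E) [IsMarkovKernel κ]
    (μ : Measure E) [IsProbabilityMeasure μ] : IsProbabilityMeasure (chainLaw κ μ) := by
  unfold chainLaw
  infer_instance

/-! ### The adaptive multilevel splitting algorithm

The state of the algorithm is the family `s : Fin n → ℕ → E` of its `n` replicas, each of which is
a (stopped) path. -/

/-- The replicas with minimal maximal level. -/
def argminSet {E : Type*} {n : ℕ} (ξ : E → ℝ) (s : Fin n → ℕ → E) : Finset (Fin n) :=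
  {i | ∀ j, maxLevel ξ (s i) ≤ maxLevel ξ (s j)}

lemma argminSet_nonempty {E : Type*} {n : ℕ} [NeZero n] (ξ : E → ℝ) (s : Fin n → ℕ → E) :
    (argminSet ξ s).Nonempty := by
  obtain ⟨i, hi⟩ := Finite.exists_min fun i => maxLevel ξ (s i)
  exact ⟨i, by simpa [argminSet] using hi⟩

/-- The replica that is killed: the one with minimal maximal level (if there are several of them,
the one with the smallest index). -/
def killed {E : Type*} {n : ℕ} [NeZero n] (ξ : E → ℝ) (s : Fin n → ℕ → E) : Fin n :=
  (argminSet ξ s).min' (argminSet_nonempty ξ s)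

/-- All the replicas have reached the level `z_B`. -/
def allReached (E : Type*) (n : ℕ) (ξ : E → ℝ) (zB : ℝ) : Set (Fin n → ℕ → E) :=
  {s | ∀ i, levelTime ξ zB (s i) ≠ ⊤}

/-- The time up to which replica `j` is copied when it is chosen to replace the killed replica. -/
def copyTime {E : Type*} {n : ℕ} [NeZero n] (ξ : E → ℝ) (𝒯 : Set ℕ) (s : Fin n → ℕ → E)
    (j : Fin n) : ℕ∞ :=
  branchTime ξ 𝒯 (maxLevel ξ (s (killed ξ s))) (s j)

/-- The new family of replicas, when replica `j` replaces the killed one and `y` is the path of the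
Markov chain used to continue the copy of replica `j`. The new replica is again stopped when it
enters `A` or exceeds `z_B`; in particular it equals replica `j` if that one is already stopped at
the copying time. -/
def update {E : Type*} {n : ℕ} [NeZero n] (ξ : E → ℝ) (A : Set E) (zB : ℝ) (𝒯 : Set ℕ)
    (s : Fin n → ℕ → E) (j : Fin n) (y : ℕ → E) : Fin n → ℕ → E :=
  Function.update s (killed ξ s) (stopPath ξ A zB (splice (copyTime ξ 𝒯 s j) (s j) y))

section Measurability

variable {E : Type*} [MeasurableSpace E] {n : ℕ} {ξ : E → ℝ} {A : Set E}

lemma measurable_killed [NeZero n] (hξ : Measurable ξ) :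
    Measurable (killed ξ : (Fin n → ℕ → E) → Fin n) := by
  have hm : ∀ i : Fin n, Measurable fun s : Fin n → ℕ → E => maxLevel ξ (s i) :=
    fun i => (measurable_maxLevel hξ).comp (measurable_pi_apply i)
  have hmem : ∀ i : Fin n, MeasurableSet {s : Fin n → ℕ → E | i ∈ argminSet ξ s} := by
    intro i
    have : {s : Fin n → ℕ → E | i ∈ argminSet ξ s} =
        ⋂ j, {s | maxLevel ξ (s i) ≤ maxLevel ξ (s j)} := by
      ext s; simp [argminSet]
    rw [this]
    exact MeasurableSet.iInter fun j => measurableSet_le (hm i) (hm j)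
  refine measurable_to_countable' fun i => ?_
  have : (killed ξ : (Fin n → ℕ → E) → Fin n) ⁻¹' {i} =
      {s | i ∈ argminSet ξ s} ∩ ⋂ j, ⋂ _ : j < i, {s | j ∈ argminSet ξ s}ᶜ := by
    ext s
    simp only [Set.mem_preimage, Set.mem_singleton_iff, Set.mem_inter_iff, Set.mem_ofPred_eq,
      Set.mem_iInter, Set.mem_compl_iff]
    constructor
    · rintro rfl
      exact ⟨Finset.min'_mem _ _, fun j hj hmj => absurd (Finset.min'_le _ j hmj) (not_le.2 hj)⟩
    · rintro ⟨h1, h2⟩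
      refine le_antisymm (Finset.min'_le _ _ h1) (not_lt.1 fun hlt => ?_)
      exact h2 _ hlt (Finset.min'_mem _ _)
  rw [this]
  exact (hmem i).inter (MeasurableSet.iInter fun j => MeasurableSet.iInter fun _ => (hmem j).compl)

lemma measurableSet_allReached (hξ : Measurable ξ) (zB : ℝ) :
    MeasurableSet (allReached E n ξ zB) := by
  have : allReached E n ξ zB = ⋂ i, {s | levelTime ξ zB (s i) ≠ ⊤} := by
    ext s; simp [allReached]
  rw [this]
  refine MeasurableSet.iInter fun i => ?_
  exact ((measurable_levelTime hξ).comp (measurable_const.prodMk (measurable_pi_apply i)))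
    (MeasurableSet.of_discrete (s := {t : ℕ∞ | t ≠ ⊤}))

lemma measurable_replica :
    Measurable fun p : (Fin n → ℕ → E) × Fin n => p.1 p.2 :=
  measurable_from_prod_countable_left fun j => measurable_pi_apply j

lemma measurable_copyTime [NeZero n] (hξ : Measurable ξ) (𝒯 : Set ℕ) :
    Measurable fun p : (Fin n → ℕ → E) × Fin n => copyTime ξ 𝒯 p.1 p.2 := by
  have h0 : Measurable fun s : Fin n → ℕ → E => (s, killed ξ s) :=
    measurable_id.prodMk (measurable_killed hξ)
  have h1 : Measurable fun s : Fin n → ℕ → E => s (killed ξ s) := measurable_replica.comp h0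
  have h2 : Measurable fun s : Fin n → ℕ → E => maxLevel ξ (s (killed ξ s)) :=
    (measurable_maxLevel hξ).comp h1
  have h3 : Measurable fun p : (Fin n → ℕ → E) × Fin n =>
      (maxLevel ξ (p.1 (killed ξ p.1)), p.1 p.2) :=
    (h2.comp measurable_fst).prodMk measurable_replica
  have h4 := (measurable_branchTime hξ 𝒯).comp h3
  exact h4

lemma measurable_copyPoint [NeZero n] (hξ : Measurable ξ) (𝒯 : Set ℕ) :
    Measurable fun p : (Fin n → ℕ → E) × Fin n => p.1 p.2 (copyTime ξ 𝒯 p.1 p.2).toNat :=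
  measurable_eval.comp
    (((Measurable.of_discrete (f := ENat.toNat)).comp (measurable_copyTime hξ 𝒯)).prodMk
      measurable_replica)

lemma measurable_update [NeZero n] (hξ : Measurable ξ) (hA : MeasurableSet A) (zB : ℝ)
    (𝒯 : Set ℕ) :
    Measurable fun p : ((Fin n → ℕ → E) × Fin n) × (ℕ → E) =>
      update ξ A zB 𝒯 p.1.1 p.1.2 p.2 := by
  have hnew : Measurable fun p : ((Fin n → ℕ → E) × Fin n) × (ℕ → E) =>
      stopPath ξ A zB (splice (copyTime ξ 𝒯 p.1.1 p.1.2) (p.1.1 p.1.2) p.2) :=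
    (measurable_stopPath hξ hA zB).comp (measurable_splice.comp
      (((measurable_copyTime hξ 𝒯).comp measurable_fst).prodMk
        ((measurable_replica.comp measurable_fst).prodMk measurable_snd)))
  refine measurable_pi_lambda _ fun i => ?_
  simp only [update, Function.update_apply]
  refine Measurable.ite ?_ hnew ((measurable_pi_apply i).comp (measurable_fst.comp measurable_fst))
  have : Measurable fun p : ((Fin n → ℕ → E) × Fin n) × (ℕ → E) => killed ξ p.1.1 :=
    (measurable_killed hξ).comp (measurable_fst.comp measurable_fst)
  exact this (MeasurableSet.of_discrete (s := {k : Fin n | i = k}))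

end Measurability

lemma others_nonempty {n : ℕ} [n.AtLeastTwo] (i : Fin n) :
    ((Finset.univ : Finset (Fin n)).erase i).Nonempty := by
  rw [← Finset.card_pos, Finset.card_erase_of_mem (Finset.mem_univ i), Finset.card_fin]
  have := Nat.AtLeastTwo.prop (n := n)
  omega

/-- The uniform distribution on the replicas other than `i`. -/
def othersKernel (n : ℕ) [n.AtLeastTwo] : Kernel (Fin n) (Fin n) :=
  Kernel.ofFunOfCountable fun i =>
    (PMF.uniformOfFinset ((Finset.univ : Finset (Fin n)).erase i) (others_nonempty i)).toMeasure

instance (n : ℕ) [n.AtLeastTwo] : IsMarkovKernel (othersKernel n) :=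
  ⟨fun _ => PMF.toMeasure.isProbabilityMeasure _⟩

section Algorithm

variable {E : Type*} [MeasurableSpace E]

/-- Law of the new family of replicas, given the current family `s` and the index `j` of the replica
chosen to replace the killed one: replica `j` is copied up to the copying time and continued by
the Markov chain started from its position at that time. -/
def resampleKernel (κ : Kernel E E) [IsMarkovKernel κ] {ξ : E → ℝ} (hξ : Measurable ξ) {A : Set E}
    (_hA : MeasurableSet A) (zB : ℝ) (𝒯 : Set ℕ) (n : ℕ) [NeZero n] :
    Kernel ((Fin n → ℕ → E) × Fin n) (Fin n → ℕ → E) :=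
  (Kernel.id ×ₖ (chainKernel κ).comap
      (fun p : (Fin n → ℕ → E) × Fin n => p.1 p.2 (copyTime ξ 𝒯 p.1 p.2).toNat)
      (measurable_copyPoint hξ 𝒯)).map
    (fun p => update ξ A zB 𝒯 p.1.1 p.1.2 p.2)

instance (κ : Kernel E E) [IsMarkovKernel κ] {ξ : E → ℝ} (hξ : Measurable ξ) {A : Set E}
    (hA : MeasurableSet A) (zB : ℝ) (𝒯 : Set ℕ) (n : ℕ) [NeZero n] :
    IsMarkovKernel (resampleKernel κ hξ hA zB 𝒯 n) :=
  Kernel.IsMarkovKernel.map _ (measurable_update hξ hA zB 𝒯)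

open scoped Classical in
/-- One iteration of the algorithm: nothing happens any more once all the replicas have reached
`z_B`; otherwise the killed replica is replaced, using a replica chosen uniformly among the others.
-/
def stepKernel (κ : Kernel E E) [IsMarkovKernel κ] {ξ : E → ℝ} (hξ : Measurable ξ) {A : Set E}
    (hA : MeasurableSet A) (zB : ℝ) (𝒯 : Set ℕ) (n : ℕ) [n.AtLeastTwo] :
    Kernel (Fin n → ℕ → E) (Fin n → ℕ → E) :=
  Kernel.piecewise (measurableSet_allReached (n := n) hξ zB) Kernel.id
    (resampleKernel κ hξ hA zB 𝒯 n ∘ₖ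
      (Kernel.id ×ₖ (othersKernel n).comap (killed ξ) (measurable_killed hξ)))

instance (κ : Kernel E E) [IsMarkovKernel κ] {ξ : E → ℝ} (hξ : Measurable ξ) {A : Set E}
    (hA : MeasurableSet A) (zB : ℝ) (𝒯 : Set ℕ) (n : ℕ) [n.AtLeastTwo] :
    IsMarkovKernel (stepKernel κ hξ hA zB 𝒯 n) := by
  unfold stepKernel
  infer_instance

/-- Law of the initial replicas: `n` independent copies of the Markov chain, each stopped when it
enters `A` or exceeds `z_B`. -/
def initialLaw (κ : Kernel E E) [IsMarkovKernel κ] (μ : Measure E) (ξ : E → ℝ) (A : Set E)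
    (zB : ℝ) (n : ℕ) : Measure (Fin n → ℕ → E) :=
  Measure.pi fun _ => (chainLaw κ μ).map (stopPath ξ A zB)

/-- Law of the run `q ↦ (X^{(1,q)}, …, X^{(n,q)})` of the algorithm, where `q = 0, 1, 2, …` is the
number of iterations that have been performed. -/
def algorithmLaw (κ : Kernel E E) [IsMarkovKernel κ] (μ : Measure E) {ξ : E → ℝ}
    (hξ : Measurable ξ) {A : Set E} (hA : MeasurableSet A) (zB : ℝ) (𝒯 : Set ℕ) (n : ℕ)
    [n.AtLeastTwo] : Measure (ℕ → Fin n → ℕ → E) :=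
  chainLaw (stepKernel κ hξ hA zB 𝒯 n) (initialLaw κ μ ξ A zB n)

end Algorithm

/-- The number of iterations performed until all the replicas have reached `z_B`
(`⊤` if this never happens). -/
def numIter {E : Type*} {n : ℕ} (ξ : E → ℝ) (zB : ℝ) (run : ℕ → Fin n → ℕ → E) : ℕ∞ :=
  firstTime fun q => run q ∈ allReached E n ξ zB

/-- `(1 - 1/n) ^ Q`, with the value `0` for `Q = ⊤`. -/
def estimator (n : ℕ) (Q : ℕ∞) : ℝ := if Q = ⊤ then 0 else (1 - 1 / (n : ℝ)) ^ Q.toNat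

end AMS

end

noncomputable section

namespace AMS

open scoped ENNReal

/-! ### The Markov property -/

section Splice

variable {E : Type*}

/-! The proof rests on an invariant of the law of the replicas, `BranchInvariant`. To branch a
replica at a level is to keep it up to its first memory time after exceeding that level and to rerun
the Markov chain from there. The invariant says that the law does not change when any one replica is
branched at the smallest maximal level of the others. For independent initial chains this is the
strong Markov property, because the branching level is independent of the branched replica.

An iteration, restricted to the event that it is performed, preserves the invariant
(`BranchInvariant.nextLaw`). Let `M` be the level of the killed replica. The new replica is already
branched at `M`, the others have level at least `M`, and branching at `M` and then higher averages
to branching at `M` (`branchAvg_branchAvg`). A surviving replica may, by the invariant, be branched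
at `M` before the replacement; by Fubini this commutes with the replacement, since the average over
copies branched at `M` does not see that the source was branched at `M`. Ties are harmless: a
replica not above the others' minimum is left unchanged by branching, and one strictly above it
stays so, hence the killed index and the termination event do not move.

The invariant also says that a branched copy of a surviving replica exceeds `z_B` with the same mean
as that replica itself. The killed replica does not exceed `z_B`, so averaging over the `n - 1`
donors multiplies the mean number of successful replicas by `n / (n - 1)`, which the weight `1 -
1/n` cancels (`BranchInvariant.weight_mul_lintegral_nextLaw`). Therefore the mean estimator and the
mean proportion of successful replicas obey the same one-step recursion. After `q` steps they differ
by at most `(1 - 1/n) ^ q`, so they agree; almost sure termination is never needed. For the initial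
law the mean proportion is the desired probability. -/

lemma splice_top (x y : ℕ → E) : splice ⊤ x y = x := by
  funext k; simp [splice]

lemma splice_coe (m : ℕ) (x y : ℕ → E) (k : ℕ) :
    splice (m : ℕ∞) x y k = if k ≤ m then x k else y (k - m) := by
  simp [splice]

lemma splice_coe_le {m k : ℕ} (x y : ℕ → E) (h : k ≤ m) : splice (m : ℕ∞) x y k = x k := by
  simp [splice_coe, h]

end Splice

section Chain

variable {E : Type*} [MeasurableSpace E]

/-- A measure on path space under which, for every `n`, the law of the position at time `n + 1`
given the path up to time `n` is given by `κ`. -/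
def IsMarkovLaw (κ : Kernel E E) (m : Measure (ℕ → E)) : Prop :=
  ∀ (n : ℕ) (g : (ℕ → E) → ℝ≥0∞), Measurable g → DependsOn g (Set.Iic (n + 1)) →
    ∫⁻ y, g y ∂m = ∫⁻ y, ∫⁻ a, g (Function.update y (n + 1) a) ∂κ (y n) ∂m

lemma measurable_lintegral_update (κ : Kernel E E) [IsMarkovKernel κ] (n : ℕ)
    {g : (ℕ → E) → ℝ≥0∞} (hg : Measurable g) :
    Measurable fun y : ℕ → E => ∫⁻ a, g (Function.update y (n + 1) a) ∂κ (y n) := by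
  have h := Measurable.lintegral_kernel_prod_right' (κ := κ.comap (fun y : ℕ → E => y n)
    (measurable_pi_apply n)) (f := fun p : (ℕ → E) × E => g (Function.update p.1 (n + 1) p.2))
    (hg.comp measurable_update')
  simpa using h

/-- Integrating out the last coordinate with `κ` turns a functional of the path up to time `n + 1`
into one of the path up to time `n`; this descends to the law at time `0`. -/
lemma IsMarkovLaw.lintegral_eq {κ : Kernel E E} [IsMarkovKernel κ] {μ ν : Measure (ℕ → E)}
    (hμ : IsMarkovLaw κ μ) (hν : IsMarkovLaw κ ν)
    (h0 : ∀ g : E → ℝ≥0∞, Measurable g → ∫⁻ y, g (y 0) ∂μ = ∫⁻ y, g (y 0) ∂ν) (n : ℕ)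
    (g : (ℕ → E) → ℝ≥0∞) (hg : Measurable g) (hd : DependsOn g (Set.Iic n)) :
    ∫⁻ y, g y ∂μ = ∫⁻ y, g y ∂ν := by
  induction n generalizing g with
  | zero =>
    have h : ∀ y, g y = g (fun _ => y 0) := fun y => hd fun i hi => by
      rw [Nat.le_zero.1 hi]
    simp_rw [h]
    exact h0 (fun a => g fun _ => a) (hg.comp (measurable_pi_lambda _ fun _ => measurable_id))
  | succ n ih =>
    rw [hμ n g hg hd, hν n g hg hd]
    refine ih _ (measurable_lintegral_update κ n hg) fun y y' hy => ?_
    rw [hy n (Set.mem_Iic.2 le_rfl)]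
    refine lintegral_congr fun a => hd fun i hi => ?_
    by_cases hin : i = n + 1
    · subst hin; simp
    · rw [Function.update_of_ne hin, Function.update_of_ne hin]
      exact hy i (by simp only [Set.mem_Iic] at hi ⊢; omega)

/-- The indicator of a cylinder over a finite set of times has a finite horizon, and the cylinders
form a generating π-system. -/
lemma IsMarkovLaw.ext {κ : Kernel E E} [IsMarkovKernel κ] {μ ν : Measure (ℕ → E)}
    [IsFiniteMeasure μ] (hμ : IsMarkovLaw κ μ) (hν : IsMarkovLaw κ ν)
    (h0 : ∀ g : E → ℝ≥0∞, Measurable g → ∫⁻ y, g (y 0) ∂μ = ∫⁻ y, g (y 0) ∂ν) : μ = ν := by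
  have key := IsMarkovLaw.lintegral_eq hμ hν h0
  refine ext_of_generate_finite _ (generateFrom_measurableCylinders (α := fun _ : ℕ => E)).symm
    isPiSystem_measurableCylinders (fun t ht => ?_) ?_
  · obtain ⟨s, S, hS, rfl⟩ := (mem_measurableCylinders _).1 ht
    have hm := hS.cylinder (α := fun _ : ℕ => E) s
    rw [← lintegral_indicator_one hm, ← lintegral_indicator_one hm]
    refine key (s.sup id) _ (measurable_one.indicator hm) fun y y' hy => ?_
    have : s.restrict y = s.restrict y' := by
      ext i
      exact hy i (Finset.le_sup (f := id) i.2)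
    have hiff : y ∈ cylinder (α := fun _ : ℕ => E) s S ↔
        y' ∈ cylinder (α := fun _ : ℕ => E) s S := by
      simp only [mem_cylinder, this]
    by_cases hc : y ∈ cylinder (α := fun _ : ℕ => E) s S
    · rw [Set.indicator_of_mem hc, Set.indicator_of_mem (hiff.1 hc)]; rfl
    · rw [Set.indicator_of_notMem hc, Set.indicator_of_notMem (fun h => hc (hiff.2 h))]
  · simpa using key 0 (fun _ => 1) measurable_const fun _ _ _ => rfl

variable (κ : Kernel E E) [IsMarkovKernel κ]

lemma isMarkovLaw_chainKernel (x : E) : IsMarkovLaw κ (chainKernel κ x) := by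
  intro n g hg hd
  simp only [chainKernel, Kernel.comap_apply]
  set K : (n : ℕ) → Kernel ((i : Finset.Iic n) → E) E := fun n =>
    κ.comap (fun h : (i : Finset.Iic n) → E => h ⟨n, Finset.mem_Iic.2 le_rfl⟩)
      (measurable_pi_apply _) with hK
  set x0 : (i : Finset.Iic 0) → E := fun _ => x
  have h1 : ∫⁻ y, g y ∂Kernel.traj (X := fun _ => E) K 0 x0 =
      ∫⁻ y, ∫⁻ w, g w ∂Kernel.traj (X := fun _ => E) K n (Preorder.frestrictLe n y)
        ∂Kernel.traj (X := fun _ => E) K 0 x0 := by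
    conv_lhs => rw [← Kernel.traj_comp_partialTraj (X := fun _ => E) (κ := K) (Nat.zero_le n),
      Kernel.lintegral_comp _ _ _ hg, ← Kernel.traj_map_frestrictLe_apply]
    rw [lintegral_map hg.lintegral_kernel (by fun_prop)]
  rw [h1]
  refine lintegral_congr fun y => ?_
  have h2 := Kernel.lmarginalPartialTraj_succ (X := fun _ => E) (κ := K) n hg y
  have h3 : K n (Preorder.frestrictLe n y) = κ (y n) := by simp [hK]
  rw [h3] at h2
  have hgu : Measurable fun z : (i : Finset.Iic (n + 1)) → E =>
      g (Function.updateFinset y (Finset.Iic (n + 1)) z) := hg.comp measurable_updateFinset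
  rw [← h2, Kernel.lmarginalPartialTraj, ← Kernel.traj_map_frestrictLe_apply,
    lintegral_map hgu (by fun_prop)]
  refine lintegral_congr fun w => hd fun i hi => ?_
  have hi' : i ∈ Finset.Iic (n + 1) := by simpa using hi
  simp [Function.updateFinset, hi']

lemma lintegral_chainKernel_zero (x : E) {g : E → ℝ≥0∞} (hg : Measurable g) :
    ∫⁻ y, g (y 0) ∂chainKernel κ x = g x := by
  simp only [chainKernel, Kernel.comap_apply]
  have hg0 : Measurable fun y : ℕ → E => g (y 0) := hg.comp (measurable_pi_apply 0)
  rw [Kernel.lintegral_traj (X := fun _ => E) _ hg0]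
  simp [Function.updateFinset]

/-- The path which starts at `x` and then follows `y`. -/
def pathCons (x : E) (y : ℕ → E) : ℕ → E
  | 0 => x
  | k + 1 => y k

lemma measurable_pathCons : Measurable fun p : E × (ℕ → E) => pathCons p.1 p.2 := by
  refine measurable_pi_lambda _ fun k => ?_
  cases k with
  | zero => exact measurable_fst
  | succ k => exact (measurable_pi_apply k).comp measurable_snd

omit [MeasurableSpace E] in
lemma update_pathCons_succ (x a : E) (y : ℕ → E) (n : ℕ) :
    Function.update (pathCons x y) (n + 1) a = pathCons x (Function.update y n a) := by
  funext k
  cases k with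
  | zero => simp [pathCons]
  | succ k => simp [pathCons, Function.update_apply]

lemma measurable_lintegral_chainKernel {Ω : Type*} [MeasurableSpace Ω] {φ : Ω → E}
    (hφ : Measurable φ) {f : Ω → (ℕ → E) → ℝ≥0∞} (hf : Measurable (Function.uncurry f)) :
    Measurable fun ω => ∫⁻ y, f ω y ∂chainKernel κ (φ ω) := by
  have h := Measurable.lintegral_kernel_prod_right' (κ := (chainKernel κ).comap φ hφ) hf
  simpa using h

lemma ae_chainKernel_zero (x : E) [MeasurableSingletonClass E] :
    ∀ᵐ y ∂chainKernel κ x, y 0 = x := by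
  have h := lintegral_chainKernel_zero κ x (g := ({x}ᶜ : Set E).indicator 1)
    (measurable_one.indicator (measurableSet_singleton x).compl)
  have hm : MeasurableSet ((fun y : ℕ → E => y 0) ⁻¹' {x}ᶜ) :=
    measurable_pi_apply 0 (measurableSet_singleton x).compl
  have h2 : chainKernel κ x ((fun y : ℕ → E => y 0) ⁻¹' {x}ᶜ) = 0 := by
    rw [← lintegral_indicator_one hm]
    rw [Set.indicator_of_notMem (by simp)] at h
    exact h
  exact h2

/-- The Markov property at time `1`. -/
lemma lintegral_chainKernel (x : E) {f : (ℕ → E) → ℝ≥0∞} (hf : Measurable f)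
    [MeasurableSingletonClass E] :
    ∫⁻ y, f y ∂chainKernel κ x =
      ∫⁻ x', ∫⁻ y, f (pathCons x y) ∂chainKernel κ x' ∂κ x := by
  have hcons : Measurable (pathCons x) := measurable_pathCons.comp measurable_prodMk_left
  set ν : Measure (ℕ → E) := ((κ x).bind (chainKernel κ)).map (pathCons x) with hν
  have hint : ∀ g : (ℕ → E) → ℝ≥0∞, Measurable g →
      ∫⁻ y, g y ∂ν = ∫⁻ x', ∫⁻ y, g (pathCons x y) ∂chainKernel κ x' ∂κ x := by
    intro g hg
    have hgc : Measurable fun y => g (pathCons x y) := hg.comp hcons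
    rw [hν, lintegral_map hg hcons, Measure.lintegral_bind (chainKernel κ).aemeasurable
      hgc.aemeasurable]
  rw [← hint f hf]
  congr 1
  -- By uniqueness of Markov laws, it suffices that the path made of `x`, a step of `κ` and a fresh
  -- chain is Markov and starts at `x`.
  refine (isMarkovLaw_chainKernel κ x).ext (κ := κ) ?_ fun g hg => ?_
  · intro n g hg hd
    rw [hint g hg, hint _ (measurable_lintegral_update κ n hg)]
    simp_rw [update_pathCons_succ]
    cases n with
    -- The first transition is treated apart: the coordinate at time `1` is the starting point of
    -- the fresh chain, almost surely the `x'` drawn from `κ x`.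
    | zero =>
      have h0 : ∀ x' y, g (pathCons x (Function.update y 0 x')) = g (pathCons x fun _ => x') := by
        intro x' y
        refine hd fun i hi => ?_
        rcases i with _ | _ | i
        · rfl
        · simp [pathCons]
        · simp only [Set.mem_Iic] at hi; omega
      simp only [h0, pathCons, lintegral_const, measure_univ, mul_one]
      refine lintegral_congr fun x' => ?_
      have h1 : ∫⁻ y, g (pathCons x y) ∂chainKernel κ x' =
          ∫⁻ _, g (pathCons x fun _ => x') ∂chainKernel κ x' := by
        refine lintegral_congr_ae ?_
        filter_upwards [ae_chainKernel_zero κ x'] with y hy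
        rw [← h0 x' y, ← hy, Function.update_eq_self]
      rw [h1, lintegral_const, measure_univ, mul_one]
    | succ n =>
      refine lintegral_congr fun x' => ?_
      have hgc : Measurable fun y => g (pathCons x y) := hg.comp hcons
      rw [isMarkovLaw_chainKernel κ x' n _ hgc fun y y' hy => ?_]
      · rfl
      · refine hd fun i hi => ?_
        cases i with
        | zero => rfl
        | succ i => exact hy i (by simp only [Set.mem_Iic] at hi ⊢; omega)
  · have hg0 : Measurable fun y : ℕ → E => g (y 0) := hg.comp (measurable_pi_apply 0)
    rw [lintegral_chainKernel_zero κ x hg, hint _ hg0]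
    simp [pathCons]

/-- The average of `f` over the continuations of `x` after time `t` by the Markov chain. -/
def contAvg (t : ℕ∞) (f : (ℕ → E) → ℝ≥0∞) (x : ℕ → E) : ℝ≥0∞ :=
  ∫⁻ y, f (splice t x y) ∂chainKernel κ (x t.toNat)

lemma contAvg_top (f : (ℕ → E) → ℝ≥0∞) (x : ℕ → E) : contAvg κ ⊤ f x = f x := by
  simp [contAvg, splice_top]

lemma measurable_contAvg (t : ℕ∞) {f : (ℕ → E) → ℝ≥0∞} (hf : Measurable f) :
    Measurable (contAvg κ t f) := by
  refine measurable_lintegral_chainKernel κ (measurable_pi_apply _) ?_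
  exact hf.comp (measurable_splice.comp
    (measurable_const.prodMk (measurable_fst.prodMk measurable_snd)))

omit [MeasurableSpace E] in
lemma splice_succ_pathCons (m : ℕ) (x : E) (y y' : ℕ → E) :
    splice ((m + 1 : ℕ) : ℕ∞) (pathCons x y) y' = pathCons x (splice (m : ℕ∞) y y') := by
  funext k
  cases k with
  | zero => rw [splice_coe, if_pos (Nat.zero_le _)]; rfl
  | succ k =>
    simp only [splice_coe, pathCons, Nat.add_le_add_iff_right, Nat.add_sub_add_right]

/-- The Markov property at a deterministic time. -/
lemma lintegral_contAvg [MeasurableSingletonClass E] (t : ℕ∞) (x : E) {f : (ℕ → E) → ℝ≥0∞}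
    (hf : Measurable f) :
    ∫⁻ y, contAvg κ t f y ∂chainKernel κ x = ∫⁻ y, f y ∂chainKernel κ x := by
  induction t using ENat.recTopCoe with
  | top => simp_rw [contAvg_top]
  | coe m =>
    induction m generalizing x f with
    | zero =>
      have : ∀ᵐ y ∂chainKernel κ x, contAvg κ ((0 : ℕ) : ℕ∞) f y = ∫⁻ y, f y ∂chainKernel κ x := by
        filter_upwards [ae_chainKernel_zero κ x] with y hy
        simp only [contAvg, ENat.toNat_natCast, hy]
        refine lintegral_congr_ae ?_
        filter_upwards [ae_chainKernel_zero κ x] with y' hy'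
        congr 1
        funext k
        cases k with
        | zero => rw [splice_coe, if_pos le_rfl, hy, hy']
        | succ k => rw [splice_coe, if_neg (by omega), Nat.sub_zero]
      rw [lintegral_congr_ae this]
      simp
    | succ m ih =>
      rw [lintegral_chainKernel κ x hf, lintegral_chainKernel κ x (measurable_contAvg κ _ hf)]
      refine lintegral_congr fun x' => ?_
      have hfc : Measurable fun y => f (pathCons x y) :=
        hf.comp (measurable_pathCons.comp measurable_prodMk_left)
      rw [← ih x' hfc]
      refine lintegral_congr fun y => ?_
      simp only [contAvg, splice_succ_pathCons, ENat.toNat_natCast]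
      rfl

end Chain

/-! ### Stopping times -/

section Stopping

variable {E : Type*}

/-- Whether `P x k` holds only depends on the path `x` up to time `k`. -/
def Adapted (P : (ℕ → E) → ℕ → Prop) : Prop :=
  ∀ x x' k, (∀ l ≤ k, x l = x' l) → P x k → P x' k

variable {P : (ℕ → E) → ℕ → Prop}

lemma Adapted.firstTime_le (hP : Adapted P) {x x' : ℕ → E} {m : ℕ} (h : ∀ l ≤ m, x l = x' l)
    (hx : firstTime (P x) ≤ m) : firstTime (P x') ≤ m := by
  obtain ⟨k, hk, hPk⟩ := (firstTime_le_iff _ _).1 hx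
  exact (firstTime_le_iff _ _).2 ⟨k, hk, hP x x' k (fun l hl => h l (hl.trans hk)) hPk⟩

lemma Adapted.firstTime_eq (hP : Adapted P) {x x' : ℕ → E} {m : ℕ} (h : ∀ l ≤ m, x l = x' l)
    (hx : firstTime (P x) = m) : firstTime (P x') = m := by
  refine le_antisymm (hP.firstTime_le h hx.le) (not_lt.1 fun hlt => ?_)
  obtain ⟨j, hj⟩ := ENat.ne_top_iff_exists.mp (hlt.trans_le le_top).ne
  rw [← hj] at hlt
  have hjm : j < m := by exact_mod_cast hlt
  have := hP.firstTime_le (fun l hl => (h l (hl.trans hjm.le)).symm) hj.symm.le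
  rw [hx] at this
  exact absurd (by exact_mod_cast this : m ≤ j) (by omega)

lemma Adapted.firstTime_splice (hP : Adapted P) {x : ℕ → E} (y : ℕ → E) :
    firstTime (P (splice (firstTime (P x)) x y)) = firstTime (P x) := by
  cases h : firstTime (P x) with
  | top => rw [splice_top, h]
  | coe m => exact hP.firstTime_eq (fun l hl => (splice_coe_le x y hl).symm) h

/-- The event that the stopping time equals `t` is decided by the path up to `t`, which resampling
after `t` does not touch. -/
lemma Adapted.firstTime_splice_eq_iff (hP : Adapted P) (t : ℕ∞) (x y : ℕ → E) :
    firstTime (P (splice t x y)) = t ↔ firstTime (P x) = t := by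
  cases t with
  | top => rw [splice_top]
  | coe m => exact ⟨hP.firstTime_eq fun l hl => splice_coe_le x y hl,
      hP.firstTime_eq fun l hl => (splice_coe_le x y hl).symm⟩

variable [MeasurableSpace E] (κ : Kernel E E) [IsMarkovKernel κ]

lemma lintegral_eq_tsum_fiber {Ω : Type*} [MeasurableSpace Ω] (m : Measure Ω) {T : Ω → ℕ∞}
    (hT : Measurable T) {f : Ω → ℝ≥0∞} (hf : Measurable f) :
    ∫⁻ ω, f ω ∂m = ∑' t, ∫⁻ ω, (T ⁻¹' {t}).indicator f ω ∂m := by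
  rw [← lintegral_tsum fun t => (hf.indicator (hT (MeasurableSet.of_discrete))).aemeasurable]
  refine lintegral_congr fun ω => ?_
  rw [tsum_eq_single (T ω) fun t ht => Set.indicator_of_notMem (fun h => ht h.symm) _]
  simp

lemma measurable_contAvg_firstTime (hPm : ∀ k, MeasurableSet {x | P x k})
    {f : (ℕ → E) → ℝ≥0∞} (hf : Measurable f) :
    Measurable fun x => contAvg κ (firstTime (P x)) f x := by
  have h : Measurable (Function.uncurry fun (t : ℕ∞) (x : ℕ → E) => contAvg κ t f x) :=
    measurable_from_prod_countable_right fun t => measurable_contAvg κ t hf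
  have hT : Measurable fun y : ℕ → E => (firstTime (P y), y) :=
    (measurable_firstTime hPm).prodMk measurable_id
  simpa only [Function.comp_def, Function.uncurry] using h.comp hT

/-- The strong Markov property. -/
lemma lintegral_contAvg_firstTime [MeasurableSingletonClass E] (hP : Adapted P)
    (hPm : ∀ k, MeasurableSet {x | P x k}) (x : E) {f : (ℕ → E) → ℝ≥0∞} (hf : Measurable f) :
    ∫⁻ y, contAvg κ (firstTime (P y)) f y ∂chainKernel κ x = ∫⁻ y, f y ∂chainKernel κ x := by
  have hT : Measurable fun y : ℕ → E => firstTime (P y) := measurable_firstTime hPm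
  -- A stopping time has countably many values, so the deterministic Markov property can be applied
  -- on each fibre. On the fibre of `⊤` nothing is resampled.
  rw [lintegral_eq_tsum_fiber _ hT hf,
    lintegral_eq_tsum_fiber _ hT (measurable_contAvg_firstTime κ hPm hf)]
  refine tsum_congr fun t => ?_
  rw [← lintegral_contAvg κ t x (hf.indicator (hT MeasurableSet.of_discrete))]
  refine lintegral_congr fun y => ?_
  by_cases hy : firstTime (P y) = t
  · rw [Set.indicator_of_mem (by simpa using hy), hy]
    refine lintegral_congr fun y' => ?_
    rw [Set.indicator_of_mem]
    simpa using (hP.firstTime_splice_eq_iff t y y').2 hy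
  · rw [Set.indicator_of_notMem (by simpa using hy), contAvg]
    rw [lintegral_congr (g := fun _ => 0), lintegral_zero]
    intro y'
    rw [Set.indicator_of_notMem]
    simpa using fun h => hy ((hP.firstTime_splice_eq_iff t y y').1 h)

end Stopping

/-! ### Branching a path at a level -/

lemma firstTime_eq_top_iff {P : ℕ → Prop} : firstTime P = ⊤ ↔ ∀ k, ¬ P k := by
  simp [firstTime]

lemma firstTime_min (P Q : ℕ → Prop) :
    min (firstTime P) (firstTime Q) = firstTime fun k => P k ∨ Q k := by
  simp only [firstTime, iInf_or, iInf_inf_eq]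

section Paths

variable {E : Type*}

/-- The path `x`, followed up to the branching time at level `z` and then continued by `y`,
stopped when it enters `A` or exceeds `z_B`. -/
def branch (ξ : E → ℝ) (A : Set E) (zB : ℝ) (𝒯 : Set ℕ) (z : EReal) (x y : ℕ → E) : ℕ → E :=
  stopPath ξ A zB (splice (branchTime ξ 𝒯 z x) x y)

variable {ξ : E → ℝ} {A : Set E} {zB : ℝ} {𝒯 : Set ℕ}

lemma levelTime_eq_top_iff {z : EReal} {x : ℕ → E} : levelTime ξ z x = ⊤ ↔ maxLevel ξ x ≤ z := by
  simp [levelTime, firstTime_eq_top_iff, maxLevel]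

lemma levelTime_le_iff {z : EReal} {x : ℕ → E} {m : ℕ} :
    levelTime ξ z x ≤ m ↔ ∃ k ≤ m, z < (ξ (x k) : EReal) :=
  firstTime_le_iff _ _

lemma lt_maxLevel {z : EReal} {x : ℕ → E} {k : ℕ} (h : z < (ξ (x k) : EReal)) :
    z < maxLevel ξ x :=
  h.trans_le (le_iSup (fun k => (ξ (x k) : EReal)) k)

lemma levelTime_mono {z w : EReal} (h : z ≤ w) (x : ℕ → E) : levelTime ξ z x ≤ levelTime ξ w x :=
  le_iInf₂ fun k hk => iInf₂_le k (h.trans_lt hk)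

lemma adapted_exit (ξ : E → ℝ) (A : Set E) (zB : ℝ) :
    Adapted fun (x : ℕ → E) k => x k ∈ A ∨ (zB : EReal) < (ξ (x k) : EReal) := by
  intro x x' k h hP
  rwa [← h k le_rfl]

lemma adapted_branch (ξ : E → ℝ) (𝒯 : Set ℕ) (z : EReal) :
    Adapted fun (x : ℕ → E) k => k ∈ 𝒯 ∧ levelTime ξ z x ≤ k := by
  rintro x x' k h ⟨hk, hP⟩
  obtain ⟨l, hl, hlz⟩ := levelTime_le_iff.1 hP
  exact ⟨hk, levelTime_le_iff.2 ⟨l, hl, by rwa [← h l hl]⟩⟩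

lemma exitTime_eq (x : ℕ → E) : min (hitTime A x) (levelTime ξ zB x) =
    firstTime fun k => x k ∈ A ∨ (zB : EReal) < (ξ (x k) : EReal) :=
  firstTime_min _ _

lemma stopPath_apply (x : ℕ → E) {k : ℕ}
    (h : (k : ℕ∞) ≤ firstTime fun k => x k ∈ A ∨ (zB : EReal) < (ξ (x k) : EReal)) :
    stopPath ξ A zB x k = x k := by
  rw [stopPath, stopAt, exitTime_eq, min_eq_left h, ENat.toNat_natCast]

lemma stopPath_apply_of_ge (x : ℕ → E) {k s : ℕ} (hs : s ≤ k)
    (h : (firstTime fun k => x k ∈ A ∨ (zB : EReal) < (ξ (x k) : EReal)) = s) :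
    stopPath ξ A zB x k = x s := by
  rw [stopPath, stopAt, exitTime_eq, h, min_eq_right (by exact_mod_cast hs), ENat.toNat_natCast]

lemma stopPath_of_exit_eq_top {x : ℕ → E}
    (h : (firstTime fun k => x k ∈ A ∨ (zB : EReal) < (ξ (x k) : EReal)) = ⊤) :
    stopPath ξ A zB x = x :=
  funext fun k => stopPath_apply x (by rw [h]; exact le_top)

/-- The exit time is a stopping time, so the stopped path is a function of the path up to that time.
-/
lemma stopPath_congr {x x' : ℕ → E} {s : ℕ}
    (hs : (firstTime fun k => x k ∈ A ∨ (zB : EReal) < (ξ (x k) : EReal)) = s)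
    (h : ∀ l ≤ s, x l = x' l) : stopPath ξ A zB x' = stopPath ξ A zB x := by
  have hs' := (adapted_exit ξ A zB).firstTime_eq h hs
  funext k
  rcases le_total k s with hk | hk
  · rw [stopPath_apply x (by rw [hs]; exact_mod_cast hk),
      stopPath_apply x' (by rw [hs']; exact_mod_cast hk), h k hk]
  · rw [stopPath_apply_of_ge x hk hs, stopPath_apply_of_ge x' hk hs', h s le_rfl]

lemma stopPath_stopPath (x : ℕ → E) :
    stopPath ξ A zB (stopPath ξ A zB x) = stopPath ξ A zB x := by
  cases hs : firstTime fun k => x k ∈ A ∨ (zB : EReal) < (ξ (x k) : EReal) with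
  | top => rw [stopPath_of_exit_eq_top hs, stopPath_of_exit_eq_top hs]
  | coe s =>
    exact stopPath_congr hs fun l hl => (stopPath_apply x (by rw [hs]; exact_mod_cast hl)).symm

lemma stopPath_branch (z : EReal) (x y : ℕ → E) :
    stopPath ξ A zB (branch ξ A zB 𝒯 z x y) = branch ξ A zB 𝒯 z x y :=
  stopPath_stopPath _

lemma branchTime_eq_top {z : EReal} {x : ℕ → E} (h : maxLevel ξ x ≤ z) :
    branchTime ξ 𝒯 z x = ⊤ := by
  rw [branchTime, firstTime_eq_top_iff]
  rintro k ⟨-, hk⟩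
  rw [levelTime_eq_top_iff.2 h] at hk
  exact ENat.natCast_ne_top k (top_le_iff.1 hk)

lemma branch_eq_self {z : EReal} {x : ℕ → E} (hx : stopPath ξ A zB x = x)
    (h : maxLevel ξ x ≤ z) (y : ℕ → E) : branch ξ A zB 𝒯 z x y = x := by
  rw [branch, branchTime_eq_top h, splice_top, hx]

/-- The copied part contains a point above `z`, since branching occurs no earlier than the passage
above `z`. If the new path exits before that point, it exits where it still agrees with `x`, so both
stopped paths coincide. -/
lemma lt_maxLevel_branch {z : EReal} {x : ℕ → E} (hx : stopPath ξ A zB x = x)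
    (h : z < maxLevel ξ x) (y : ℕ → E) : z < maxLevel ξ (branch ξ A zB 𝒯 z x y) := by
  rw [branch]
  cases hT : branchTime ξ 𝒯 z x with
  | top => rwa [splice_top, hx]
  | coe m =>
    obtain ⟨k, hkm, -, hk⟩ := (firstTime_le_iff _ m).1 hT.le
    obtain ⟨l, hlk, hl⟩ := levelTime_le_iff.1 hk
    have hagree : ∀ i ≤ m, x i = splice (m : ℕ∞) x y i := fun i hi => (splice_coe_le x y hi).symm
    cases hs : firstTime fun k => splice (m : ℕ∞) x y k ∈ A ∨
        (zB : EReal) < (ξ (splice (m : ℕ∞) x y k) : EReal) with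
    | top => exact lt_maxLevel (k := l) (by
        rwa [stopPath_of_exit_eq_top hs, ← hagree l (by omega)])
    | coe s =>
      rcases le_total l s with hls | hls
      · exact lt_maxLevel (k := l) (by
          rwa [stopPath_apply _ (by rw [hs]; exact_mod_cast hls), ← hagree l (by omega)])
      · have : stopPath ξ A zB (splice (m : ℕ∞) x y) = stopPath ξ A zB x :=
          (stopPath_congr hs fun i hi => (hagree i (by omega)).symm).symm
        rw [this, hx]
        exact h

lemma le_maxLevel_branch {z : EReal} {x : ℕ → E} (hx : stopPath ξ A zB x = x)
    (h : z ≤ maxLevel ξ x) (y : ℕ → E) : z ≤ maxLevel ξ (branch ξ A zB 𝒯 z x y) := by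
  rcases h.lt_or_eq with h | h
  · exact (lt_maxLevel_branch hx h y).le
  · rw [branch_eq_self hx h.ge]
    exact h.le

lemma splice_congr_left {m : ℕ} {x x' : ℕ → E} (h : ∀ l ≤ m, x l = x' l) (y : ℕ → E) :
    splice (m : ℕ∞) x y = splice (m : ℕ∞) x' y := by
  funext k
  by_cases hk : k ≤ m
  · rw [splice_coe_le _ _ hk, splice_coe_le _ _ hk, h k hk]
  · simp [splice_coe, hk]

lemma splice_add_splice (m k : ℕ) (x y y' : ℕ → E) :
    splice ((m + k : ℕ) : ℕ∞) (splice (m : ℕ∞) x y) y' =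
      splice (m : ℕ∞) x (splice (k : ℕ∞) y y') := by
  funext l
  simp only [splice_coe]
  split_ifs <;> first | rfl | omega | (congr 1; omega)

end Paths

/-! ### Averages over branched paths -/

section Averages

variable {E : Type*} [MeasurableSpace E] (κ : Kernel E E) [IsMarkovKernel κ]
  (ξ : E → ℝ) (A : Set E) (zB : ℝ) (𝒯 : Set ℕ)

/-- The average of `f` over the paths obtained by branching `x` at level `z`. -/
def branchAvg (z : EReal) (f : (ℕ → E) → ℝ≥0∞) (x : ℕ → E) : ℝ≥0∞ :=
  ∫⁻ y, f (branch ξ A zB 𝒯 z x y) ∂chainKernel κ (x (branchTime ξ 𝒯 z x).toNat)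

variable {ξ A zB 𝒯}

lemma branchAvg_eq_contAvg (z : EReal) (f : (ℕ → E) → ℝ≥0∞) (x : ℕ → E) :
    branchAvg κ ξ A zB 𝒯 z f x =
      contAvg κ (branchTime ξ 𝒯 z x) (fun x' => f (stopPath ξ A zB x')) x := rfl

lemma contAvg_congr {m : ℕ} {x x' : ℕ → E} (h : ∀ l ≤ m, x l = x' l) (f : (ℕ → E) → ℝ≥0∞) :
    contAvg κ m f x = contAvg κ m f x' := by
  simp only [contAvg, ENat.toNat_natCast, h m le_rfl, splice_congr_left h]

lemma contAvg_stop_of_exit_le {t : ℕ∞} {s : ℕ} {x : ℕ → E} (f : (ℕ → E) → ℝ≥0∞)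
    (hs : (firstTime fun k => x k ∈ A ∨ (zB : EReal) < (ξ (x k) : EReal)) = s) (hst : s ≤ t) :
    contAvg κ t (fun x' => f (stopPath ξ A zB x')) x = f (stopPath ξ A zB x) := by
  have h : ∀ y, stopPath ξ A zB (splice t x y) = stopPath ξ A zB x := fun y =>
    stopPath_congr hs fun l hl => by
      have : (l : ℕ∞) ≤ t := le_trans (by exact_mod_cast hl) hst
      simp [splice, this]
  simp [contAvg, h]

/-- Replicas are stored stopped, while the Markov property concerns unstopped chains; this passes
between the two. If branching happens before the exit, stopping has not changed the relevant part of
the path. Otherwise the continuation is erased by the final stopping. -/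
lemma branchAvg_stopPath (z : EReal) (f : (ℕ → E) → ℝ≥0∞) (x : ℕ → E) :
    branchAvg κ ξ A zB 𝒯 z f (stopPath ξ A zB x) = branchAvg κ ξ A zB 𝒯 z f x := by
  cases hs : firstTime fun k => x k ∈ A ∨ (zB : EReal) < (ξ (x k) : EReal) with
  | top => rw [stopPath_of_exit_eq_top hs]
  | coe s =>
    have hagree : ∀ l ≤ s, x l = stopPath ξ A zB x l := fun l hl =>
      (stopPath_apply x (by rw [hs]; exact_mod_cast hl)).symm
    have hP := adapted_branch ξ 𝒯 z
    rw [branchAvg_eq_contAvg, branchAvg_eq_contAvg]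
    rcases le_total (branchTime ξ 𝒯 z x) s with hT | hT
    · obtain ⟨m, hm⟩ := ENat.ne_top_iff_exists.mp (ne_top_of_le_ne_top (ENat.natCast_ne_top s) hT)
      rw [← hm] at hT
      have hms : m ≤ s := by exact_mod_cast hT
      have h1 : branchTime ξ 𝒯 z (stopPath ξ A zB x) = m :=
        hP.firstTime_eq (fun l hl => hagree l (hl.trans hms)) hm.symm
      rw [h1, ← hm]
      exact (contAvg_congr κ (fun l hl => hagree l (hl.trans hms)) _).symm
    -- Freezing the path at the exit may change its branching time, but cannot bring it before the
    -- exit.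
    · have h1 : (s : ℕ∞) ≤ branchTime ξ 𝒯 z (stopPath ξ A zB x) := by
        refine not_lt.1 fun hlt => ?_
        obtain ⟨m, hm⟩ := ENat.ne_top_iff_exists.mp (hlt.trans_le le_top).ne
        rw [← hm] at hlt
        have hms : m < s := by exact_mod_cast hlt
        have h2 : branchTime ξ 𝒯 z x = m :=
          hP.firstTime_eq (fun l hl => (hagree l (hl.trans hms.le)).symm) hm.symm
        rw [h2] at hT
        exact absurd (by exact_mod_cast hT : s ≤ m) (by omega)
      rw [contAvg_stop_of_exit_le κ f ((adapted_exit ξ A zB).firstTime_eq hagree hs) h1,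
        contAvg_stop_of_exit_le κ f hs hT, stopPath_stopPath]

/-- The average depends only on the path up to its branching time, and branching preserves both that
part and that time. -/
lemma branchAvg_branch (z : EReal) (f : (ℕ → E) → ℝ≥0∞) (x y : ℕ → E) :
    branchAvg κ ξ A zB 𝒯 z f (branch ξ A zB 𝒯 z x y) = branchAvg κ ξ A zB 𝒯 z f x := by
  rw [branch, branchAvg_stopPath, branchAvg_eq_contAvg, branchAvg_eq_contAvg,
    show branchTime ξ 𝒯 z (splice (branchTime ξ 𝒯 z x) x y) = branchTime ξ 𝒯 z x from
      (adapted_branch ξ 𝒯 z).firstTime_splice y]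
  cases branchTime ξ 𝒯 z x with
  | top => rw [splice_top]
  | coe m => exact contAvg_congr κ (fun l hl => splice_coe_le x y hl) _

variable (hξ : Measurable ξ) (hA : MeasurableSet A)

include hξ in
lemma measurableSet_branch (z : EReal) (k : ℕ) :
    MeasurableSet {x : ℕ → E | k ∈ 𝒯 ∧ levelTime ξ z x ≤ k} := by
  have h : Measurable fun x : ℕ → E => levelTime ξ z x :=
    (measurable_levelTime hξ).comp measurable_prodMk_left
  by_cases hk : k ∈ 𝒯
  · simp only [hk, true_and]
    exact h (MeasurableSet.of_discrete (s := {t : ℕ∞ | t ≤ k}))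
  · simp [hk]

include hξ hA in
lemma measurable_branchAvg_param {Ω : Type*} [MeasurableSpace Ω] {z : Ω → EReal} {x : Ω → ℕ → E}
    {f : Ω → (ℕ → E) → ℝ≥0∞} (hz : Measurable z) (hx : Measurable x)
    (hf : Measurable (Function.uncurry f)) :
    Measurable fun ω => branchAvg κ ξ A zB 𝒯 (z ω) (f ω) (x ω) := by
  have hT : Measurable fun ω => branchTime ξ 𝒯 (z ω) (x ω) := by
    have h := (measurable_branchTime hξ 𝒯).comp (hz.prodMk hx)
    exact h
  have hpt : Measurable fun ω => x ω (branchTime ξ 𝒯 (z ω) (x ω)).toNat := by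
    have h := measurable_eval.comp (((Measurable.of_discrete (f := ENat.toNat)).comp hT).prodMk hx)
    simpa only [Function.comp_def] using h
  have hbr : Measurable fun p : Ω × (ℕ → E) => branch ξ A zB 𝒯 (z p.1) (x p.1) p.2 :=
    (measurable_stopPath hξ hA zB).comp (measurable_splice.comp
      ((hT.comp measurable_fst).prodMk ((hx.comp measurable_fst).prodMk measurable_snd)))
  exact measurable_lintegral_chainKernel κ hpt (f := fun ω y => f ω (branch ξ A zB 𝒯 (z ω) (x ω) y))
    (hf.comp (measurable_fst.prodMk hbr))

variable [MeasurableSingletonClass E]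

include hξ hA in
-- This is the strong Markov property at the branching time.
lemma lintegral_branchAvg (z : EReal) (x : E) {f : (ℕ → E) → ℝ≥0∞} (hf : Measurable f) :
    ∫⁻ y, branchAvg κ ξ A zB 𝒯 z f y ∂chainKernel κ x =
      ∫⁻ y, f (stopPath ξ A zB y) ∂chainKernel κ x :=
  lintegral_contAvg_firstTime κ (adapted_branch ξ 𝒯 z) (measurableSet_branch hξ z) x
    (hf.comp (measurable_stopPath hξ hA zB))

include hξ hA in
/-- Branching at level `z` and then at a higher level `w` amounts to branching at level `z`. -/
lemma branchAvg_branchAvg {z w : EReal} (hzw : z ≤ w) (x : ℕ → E) {f : (ℕ → E) → ℝ≥0∞}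
    (hf : Measurable f) :
    branchAvg κ ξ A zB 𝒯 z (branchAvg κ ξ A zB 𝒯 w f) x = branchAvg κ ξ A zB 𝒯 z f x := by
  rw [branchAvg_eq_contAvg]
  simp only [branchAvg_stopPath]
  rw [branchAvg_eq_contAvg]
  simp only [branchAvg_eq_contAvg]
  set g : (ℕ → E) → ℝ≥0∞ := fun x' => f (stopPath ξ A zB x') with hg
  have hgm : Measurable g := hf.comp (measurable_stopPath hξ hA zB)
  have hmono : branchTime ξ 𝒯 z x ≤ branchTime ξ 𝒯 w x :=
    le_iInf₂ fun k hk => iInf₂_le k ⟨hk.1, (levelTime_mono hzw x).trans hk.2⟩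
  cases hT : branchTime ξ 𝒯 z x with
  | top =>
    rw [hT, top_le_iff] at hmono
    rw [contAvg_top, contAvg_top, hmono, contAvg_top]
  | coe m =>
    -- `Q` describes the branching time at level `w` in the clock of the continuation `y`, restarted
    -- at time `m`; since `z ≤ w`, this time is at least `m`. The strong Markov property is then
    -- applied to `y`.
    set Q : (ℕ → E) → ℕ → Prop := fun y k =>
      m + k ∈ 𝒯 ∧ levelTime ξ w (splice (m : ℕ∞) x y) ≤ (m + k : ℕ) with hQ
    have hspm : Measurable fun y => splice (m : ℕ∞) x y :=
      measurable_splice.comp (measurable_const.prodMk (measurable_const.prodMk measurable_id))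
    have hQa : Adapted Q := fun y y' k h hy =>
      adapted_branch ξ 𝒯 w _ _ _ (fun l hl => by
        simp only [splice_coe]
        split_ifs
        · rfl
        · exact h _ (by omega)) hy
    have hQm : ∀ k, MeasurableSet {y | Q y k} := fun k => hspm (measurableSet_branch hξ w (m + k))
    have hTQ : ∀ y, branchTime ξ 𝒯 w (splice (m : ℕ∞) x y) = m + firstTime (Q y) := by
      intro y
      have hlow : ∀ k, k ∈ 𝒯 ∧ levelTime ξ w (splice (m : ℕ∞) x y) ≤ k → m ≤ k := by
        intro k hk
        by_contra hkm
        have h1 := adapted_branch ξ 𝒯 w _ x k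
          (fun l hl => splice_coe_le x y (by omega : l ≤ m)) hk
        have h2 : branchTime ξ 𝒯 w x ≤ k := iInf₂_le k h1
        have h3 := (hT ▸ hmono).trans h2
        exact hkm (by exact_mod_cast h3)
      refine le_antisymm ?_ (le_iInf₂ fun k hk => ?_)
      · cases hF : firstTime (Q y) with
        | top => simp
        | coe k =>
          obtain ⟨k', hk', h1⟩ := (firstTime_le_iff _ k).1 hF.le
          refine (iInf₂_le (m + k') h1).trans ?_
          exact_mod_cast (by omega : m + k' ≤ m + k)
      · obtain ⟨j, rfl⟩ := Nat.exists_eq_add_of_le (hlow k hk)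
        have : firstTime (Q y) ≤ j := iInf₂_le j hk
        push_cast
        gcongr
    -- The equality is only almost sure: at time `m` the spliced path shows `x m`, whereas the
    -- continuation shows `y 0`.
    have key : ∀ᵐ y ∂chainKernel κ (x m), contAvg κ (branchTime ξ 𝒯 w (splice (m : ℕ∞) x y)) g
        (splice (m : ℕ∞) x y) =
        contAvg κ (firstTime (Q y)) (fun y' => g (splice (m : ℕ∞) x y')) y := by
      filter_upwards [ae_chainKernel_zero κ (x m)] with y hy
      rw [hTQ]
      cases firstTime (Q y) with
      | top => simp [contAvg_top]
      | coe k =>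
        have hpt : splice (m : ℕ∞) x y (m + k) = y k := by
          rcases Nat.eq_zero_or_pos k with rfl | hk
          · rw [Nat.add_zero, splice_coe_le x y le_rfl, hy]
          · rw [splice_coe, if_neg (by omega), Nat.add_sub_cancel_left]
        rw [← Nat.cast_add]
        simp only [contAvg, ENat.toNat_natCast, hpt, splice_add_splice]
    have hgs : Measurable fun y => g (splice (m : ℕ∞) x y) := hgm.comp hspm
    rw [contAvg, ENat.toNat_natCast, lintegral_congr_ae key,
      lintegral_contAvg_firstTime κ hQa hQm (x m) hgs]
    rfl

end Averages

/-! ### Families of replicas invariant under branching at the level of the others -/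

section Deterministic

variable {E : Type*} {n : ℕ} {ξ : E → ℝ} {A : Set E} {zB : ℝ} {𝒯 : Set ℕ}

/-- The smallest maximal level of the replicas other than `i`. -/
def othersMin (ξ : E → ℝ) (s : Fin n → ℕ → E) (i : Fin n) : EReal :=
  ⨅ (l) (_ : l ≠ i), maxLevel ξ (s l)

lemma othersMin_update (s : Fin n → ℕ → E) (i : Fin n) (a : ℕ → E) :
    othersMin ξ (Function.update s i a) i = othersMin ξ s i :=
  iInf_congr fun l => iInf_congr fun hl => by rw [Function.update_of_ne hl]

lemma killed_eq_iff [NeZero n] {s : Fin n → ℕ → E} {k : Fin n} : killed ξ s = k ↔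
    (∀ j, maxLevel ξ (s k) ≤ maxLevel ξ (s j)) ∧ ∀ j < k, maxLevel ξ (s k) < maxLevel ξ (s j) := by
  have hmem : ∀ i, i ∈ argminSet ξ s ↔ ∀ j, maxLevel ξ (s i) ≤ maxLevel ξ (s j) := fun i => by
    simp [argminSet]
  constructor
  · rintro rfl
    have h1 := (hmem _).1 ((argminSet ξ s).min'_mem (argminSet_nonempty ξ s))
    refine ⟨h1, fun j hj => lt_of_le_of_ne (h1 j) fun he => ?_⟩
    have h2 : j ∈ argminSet ξ s := (hmem j).2 fun l => he ▸ h1 l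
    exact absurd ((argminSet ξ s).min'_le j h2) (not_le.2 hj)
  · rintro ⟨h1, h2⟩
    refine le_antisymm ((argminSet ξ s).min'_le k ((hmem k).2 h1)) (not_lt.1 fun hlt => ?_)
    exact absurd ((hmem _).1 ((argminSet ξ s).min'_mem (argminSet_nonempty ξ s)) k)
      (not_le.2 (h2 _ hlt))

lemma mem_allReached_iff {s : Fin n → ℕ → E} :
    s ∈ allReached E n ξ zB ↔ ∀ i, (zB : EReal) < maxLevel ξ (s i) := by
  simp only [allReached, Set.mem_ofPred_eq, ne_eq, levelTime_eq_top_iff, not_le]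

/-- The families of replicas, not all of which have reached `z_B`, in which `k` is killed. -/
def killSet (E : Type*) {n : ℕ} [NeZero n] (ξ : E → ℝ) (zB : ℝ) (k : Fin n) :
    Set (Fin n → ℕ → E) :=
  {s | killed ξ s = k} \ allReached E n ξ zB

lemma mem_killSet_iff [NeZero n] {s : Fin n → ℕ → E} {k : Fin n} : s ∈ killSet E ξ zB k ↔
    (∀ j, maxLevel ξ (s k) ≤ maxLevel ξ (s j)) ∧
      (∀ j < k, maxLevel ξ (s k) < maxLevel ξ (s j)) ∧ maxLevel ξ (s k) ≤ zB := by
  rw [killSet, Set.mem_sdiff, Set.mem_ofPred_eq, killed_eq_iff, mem_allReached_iff, and_assoc]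
  refine and_congr_right fun h1 => and_congr_right fun _ => ⟨fun h => ?_, fun h h' => ?_⟩
  · by_contra hlt
    exact h fun i => (not_le.1 hlt).trans_le (h1 i)
  · exact absurd (h' k) (not_lt.2 h)

/-- For a surviving replica, the level appearing in `BranchInvariant` is thus the level at which the
algorithm branches it. -/
lemma othersMin_eq {s : Fin n → ℕ → E} {k i : Fin n}
    (hk : ∀ j, maxLevel ξ (s k) ≤ maxLevel ξ (s j)) (hik : i ≠ k) :
    othersMin ξ s i = maxLevel ξ (s k) :=
  le_antisymm (iInf₂_le k hik.symm) (le_iInf₂ fun l _ => hk l)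

/-- A replica strictly above all the others' minimum is not the killed one, and it plays no part in
the tie-break as long as it stays strictly above. -/
lemma update_mem_killSet [NeZero n] {s : Fin n → ℕ → E} {k i : Fin n} {b : ℕ → E}
    (hi : othersMin ξ s i < maxLevel ξ (s i)) (hb : othersMin ξ s i < maxLevel ξ b)
    (hs : s ∈ killSet E ξ zB k) : Function.update s i b ∈ killSet E ξ zB k := by
  obtain ⟨h1, h2, h3⟩ := mem_killSet_iff.1 hs
  have hik : i ≠ k := by
    rintro rfl
    exact absurd hi (not_lt.2 (le_iInf₂ fun l _ => h1 l))
  rw [othersMin_eq h1 hik] at hb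
  refine mem_killSet_iff.2 ⟨fun j => ?_, fun j hj => ?_, ?_⟩ <;>
    rw [Function.update_of_ne hik.symm]
  · by_cases hj : j = i
    · subst hj; rw [Function.update_self]; exact hb.le
    · rw [Function.update_of_ne hj]; exact h1 j
  · by_cases hji : j = i
    · subst hji; rw [Function.update_self]; exact hb
    · rw [Function.update_of_ne hji]; exact h2 j hj
  · exact h3

/-- Either replica `i` is not above the others' minimum and branching leaves it unchanged, or it is
strictly above before and after. The converse direction puts the original path back. -/
lemma update_branch_mem_killSet_iff [NeZero n] {s : Fin n → ℕ → E} {k i : Fin n}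
    (hs : stopPath ξ A zB (s i) = s i) (y : ℕ → E) :
    Function.update s i (branch ξ A zB 𝒯 (othersMin ξ s i) (s i) y) ∈ killSet E ξ zB k ↔
      s ∈ killSet E ξ zB k := by
  rcases le_or_gt (maxLevel ξ (s i)) (othersMin ξ s i) with h | h
  · rw [branch_eq_self hs h, Function.update_eq_self]
  · have hb := lt_maxLevel_branch (𝒯 := 𝒯) hs h y
    refine ⟨fun hm => ?_, update_mem_killSet h hb⟩
    have := update_mem_killSet (i := i) (b := s i) (by
      rwa [othersMin_update, Function.update_self]) (by rwa [othersMin_update]) hm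
    rwa [Function.update_idem, Function.update_eq_self] at this

end Deterministic

/-! ### Invariance of a law under branching -/

section Invariance

variable {E : Type*} [MeasurableSpace E] (κ : Kernel E E) [IsMarkovKernel κ] {n : ℕ}
  (ξ : E → ℝ) (A : Set E) (zB : ℝ) (𝒯 : Set ℕ)

/-- The average of `h` when replica `i` is branched at the smallest maximal level of the others. -/
def coordAvg (i : Fin n) (h : (Fin n → ℕ → E) → ℝ≥0∞) (s : Fin n → ℕ → E) : ℝ≥0∞ :=
  branchAvg κ ξ A zB 𝒯 (othersMin ξ s i) (fun a => h (Function.update s i a)) (s i)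

/-- The law `η` of a family of replicas does not change when one of the replicas is branched at the
smallest maximal level of the others. -/
def BranchInvariant (η : Measure (Fin n → ℕ → E)) : Prop :=
  ∀ (i : Fin n) (h : (Fin n → ℕ → E) → ℝ≥0∞), Measurable h →
    ∫⁻ s, coordAvg κ ξ A zB 𝒯 i h s ∂η = ∫⁻ s, h s ∂η

/-- The average of `h` when replica `k` is killed and replaced by a branched copy of replica `j`. -/
def replaceAvg (k j : Fin n) (h : (Fin n → ℕ → E) → ℝ≥0∞) (s : Fin n → ℕ → E) : ℝ≥0∞ :=
  branchAvg κ ξ A zB 𝒯 (maxLevel ξ (s k)) (fun a => h (Function.update s k a)) (s j)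

variable {ξ A zB 𝒯} (hξ : Measurable ξ) (hA : MeasurableSet A)

include hξ in
lemma measurable_maxLevel_apply (i : Fin n) :
    Measurable fun s : Fin n → ℕ → E => maxLevel ξ (s i) :=
  (measurable_maxLevel hξ).comp (measurable_pi_apply i)

include hξ in
lemma measurable_othersMin (i : Fin n) :
    Measurable fun s : Fin n → ℕ → E => othersMin ξ s i :=
  Measurable.iInf fun l => Measurable.iInf fun _ => measurable_maxLevel_apply hξ l

lemma measurable_update_uncurry (i : Fin n) {h : (Fin n → ℕ → E) → ℝ≥0∞}
    (hh : Measurable h) :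
    Measurable (Function.uncurry fun (s : Fin n → ℕ → E) a => h (Function.update s i a)) :=
  hh.comp (measurable_update' (a := i))

include hξ hA in
lemma measurable_coordAvg (i : Fin n) {h : (Fin n → ℕ → E) → ℝ≥0∞} (hh : Measurable h) :
    Measurable (coordAvg κ ξ A zB 𝒯 i h) :=
  measurable_branchAvg_param κ hξ hA (measurable_othersMin hξ i) (measurable_pi_apply i)
    (measurable_update_uncurry i hh)

include hξ hA in
lemma measurable_replaceAvg (k j : Fin n) {h : (Fin n → ℕ → E) → ℝ≥0∞} (hh : Measurable h) :
    Measurable (replaceAvg κ ξ A zB 𝒯 k j h) :=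
  measurable_branchAvg_param κ hξ hA (measurable_maxLevel_apply hξ k) (measurable_pi_apply j)
    (measurable_update_uncurry k hh)

include hξ in
lemma measurableSet_killSet [NeZero n] (k : Fin n) : MeasurableSet (killSet E ξ zB k) :=
  (measurable_killed hξ (MeasurableSet.of_discrete (s := {k}))).diff
    (measurableSet_allReached hξ zB)

variable {κ}

lemma BranchInvariant.restrict {η : Measure (Fin n → ℕ → E)}
    (hη : BranchInvariant κ ξ A zB 𝒯 η)
    (hstopped : ∀ᵐ s ∂η, ∀ i, stopPath ξ A zB (s i) = s i) {B : Set (Fin n → ℕ → E)}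
    (hB : MeasurableSet B)
    (hBs : ∀ s i y, stopPath ξ A zB (s i) = s i →
      (Function.update s i (branch ξ A zB 𝒯 (othersMin ξ s i) (s i) y) ∈ B ↔ s ∈ B)) :
    BranchInvariant κ ξ A zB 𝒯 (η.restrict B) := by
  intro i h hh
  rw [← lintegral_indicator hB, ← lintegral_indicator hB, ← hη i _ (hh.indicator hB)]
  refine lintegral_congr_ae ?_
  filter_upwards [hstopped] with s hs
  by_cases hsB : s ∈ B
  · rw [Set.indicator_of_mem hsB]
    refine lintegral_congr fun y => ?_
    beta_reduce
    rw [Set.indicator_of_mem ((hBs s i y (hs i)).2 hsB)]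
  · rw [Set.indicator_of_notMem hsB, coordAvg, branchAvg]
    rw [lintegral_congr (g := fun _ => 0), lintegral_zero]
    intro y
    rw [Set.indicator_of_notMem fun hm => hsB ((hBs s i y (hs i)).1 hm)]

include hξ hA in
-- Branched paths are stopped by construction, so testing the invariance on the event that replica
-- `i` is not stopped gives measure zero.
lemma BranchInvariant.ae_stopPath [TopologicalSpace E] [PolishSpace E] [BorelSpace E]
    {η : Measure (Fin n → ℕ → E)} (hη : BranchInvariant κ ξ A zB 𝒯 η) :
    ∀ᵐ s ∂η, ∀ i, stopPath ξ A zB (s i) = s i := by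
  refine ae_all_iff.2 fun i => ?_
  have hm : MeasurableSet {s : Fin n → ℕ → E | stopPath ξ A zB (s i) = s i} := by
    have : {s : Fin n → ℕ → E | stopPath ξ A zB (s i) = s i} =
        ⋂ k, {s | stopPath ξ A zB (s i) k = s i k} := by
      ext s; simp [funext_iff]
    rw [this]
    have hs : Measurable fun s : Fin n → ℕ → E => stopPath ξ A zB (s i) :=
      (measurable_stopPath hξ hA zB).comp (measurable_pi_apply i)
    exact MeasurableSet.iInter fun k => measurableSet_eq_fun ((measurable_pi_apply k).comp hs)
      ((measurable_pi_apply k).comp (measurable_pi_apply i))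
  have h := hη i _ (measurable_one.indicator hm.compl)
  rw [lintegral_indicator_one hm.compl] at h
  rw [ae_iff]
  refine h.symm.trans ?_
  rw [lintegral_congr (g := fun _ => 0), lintegral_zero]
  intro s
  rw [coordAvg, branchAvg, lintegral_congr (g := fun _ => 0), lintegral_zero]
  intro y
  rw [Set.indicator_of_notMem]
  simp [stopPath_branch]

include hξ hA in
/-- Branching the replicas commutes with the replacement of a killed replica. -/
lemma BranchInvariant.lintegral_replaceAvg_coordAvg [MeasurableSingletonClass E] [NeZero n]
    {η : Measure (Fin n → ℕ → E)}
    (hη : BranchInvariant κ ξ A zB 𝒯 η) (hstopped : ∀ᵐ s ∂η, ∀ i, stopPath ξ A zB (s i) = s i)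
    {k j : Fin n} (hjk : j ≠ k) (hk : ∀ᵐ s ∂η, s ∈ killSet E ξ zB k) (i : Fin n)
    {h : (Fin n → ℕ → E) → ℝ≥0∞} (hh : Measurable h) :
    ∫⁻ s, replaceAvg κ ξ A zB 𝒯 k j (coordAvg κ ξ A zB 𝒯 i h) s ∂η =
      ∫⁻ s, replaceAvg κ ξ A zB 𝒯 k j h s ∂η := by
  have hup : ∀ (s : Fin n → ℕ → E) l, Measurable fun a => h (Function.update s l a) :=
    fun s l => hh.comp (_root_.measurable_update s)
  by_cases hik : i = k
  -- The new replica is branched at the killed level, then at the minimum of the survivors, which is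
  -- at least as high.
  · subst hik
    refine lintegral_congr_ae ?_
    filter_upwards [hk] with s hs
    have hle : maxLevel ξ (s i) ≤ othersMin ξ s i :=
      le_iInf₂ fun l _ => (mem_killSet_iff.1 hs).1 l
    simp only [replaceAvg, coordAvg, othersMin_update, Function.update_idem, Function.update_self]
    exact branchAvg_branchAvg κ hξ hA hle (s j) (hup s i)
  -- For a survivor, the invariance of `η` inserts a branching of replica `i` before the replacement
  -- on both sides.
  · rw [← hη i _ (measurable_replaceAvg κ hξ hA k j (measurable_coordAvg κ hξ hA i hh)),
      ← hη i _ (measurable_replaceAvg κ hξ hA k j hh)]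
    refine lintegral_congr_ae ?_
    filter_upwards [hk, hstopped] with s hs hst
    have hmin := (mem_killSet_iff.1 hs).1
    set z := maxLevel ξ (s k) with hz
    have hoz : othersMin ξ s i = z := othersMin_eq hmin hik
    -- The donor may be replica `i` itself; the average over its copies is still unaffected by
    -- branching it at the same level.
    have hj : ∀ (f : (ℕ → E) → ℝ≥0∞) (y : ℕ → E), branchAvg κ ξ A zB 𝒯 z f
        (Function.update s i (branch ξ A zB 𝒯 z (s i) y) j) = branchAvg κ ξ A zB 𝒯 z f (s j) := by
      intro f y
      by_cases hji : j = i
      · subst hji; rw [Function.update_self, branchAvg_branch]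
      · rw [Function.update_of_ne hji]
    have hswap : ∀ g : (ℕ → E) → (ℕ → E) → ℝ≥0∞, Measurable (Function.uncurry g) →
        branchAvg κ ξ A zB 𝒯 z (fun b => branchAvg κ ξ A zB 𝒯 z (fun a => g b a) (s j)) (s i) =
        branchAvg κ ξ A zB 𝒯 z (fun a => branchAvg κ ξ A zB 𝒯 z (fun b => g b a) (s i)) (s j) := by
      intro g hg
      have hbr : ∀ l, Measurable fun y => branch ξ A zB 𝒯 z (s l) y := fun l =>
        (measurable_stopPath hξ hA zB).comp (measurable_splice.comp
          (measurable_const.prodMk (measurable_const.prodMk measurable_id)))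
      exact lintegral_lintegral_swap (hg.comp
        (((hbr i).comp measurable_fst).prodMk ((hbr j).comp measurable_snd))).aemeasurable
    have hexp : ∀ h' : (Fin n → ℕ → E) → ℝ≥0∞,
        coordAvg κ ξ A zB 𝒯 i (replaceAvg κ ξ A zB 𝒯 k j h') s =
        branchAvg κ ξ A zB 𝒯 z (fun b => branchAvg κ ξ A zB 𝒯 z
          (fun a => h' (Function.update (Function.update s i b) k a)) (s j)) (s i) := by
      intro h'
      rw [coordAvg, hoz]
      refine lintegral_congr fun y => ?_
      simp only [replaceAvg, Function.update_of_ne (Ne.symm hik), ← hz]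
      exact hj _ y
    have hupd : Measurable fun p : (ℕ → E) × (ℕ → E) =>
        Function.update (Function.update s i p.1) k p.2 := by
      have h1 : Measurable fun p : (ℕ → E) × (ℕ → E) => (Function.update s i p.1, p.2) :=
        ((_root_.measurable_update s).comp measurable_fst).prodMk measurable_snd
      have h2 := (measurable_update' (a := k)).comp h1
      exact h2
    rw [hexp, hexp,
      hswap (fun b a => h (Function.update (Function.update s i b) k a)) (hh.comp hupd),
      hswap (fun b a => coordAvg κ ξ A zB 𝒯 i h (Function.update (Function.update s i b) k a))
        ((measurable_coordAvg κ hξ hA i hh).comp hupd)]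
    refine lintegral_congr fun y => ?_
    set a := branch ξ A zB 𝒯 z (s j) y with ha
    have hza : z ≤ maxLevel ξ a := le_maxLevel_branch (hst j) (hmin j) y
    -- After the replacement the others are all at level at least `z`, so the second branching of
    -- replica `i` is absorbed by the first.
    have hle : z ≤ othersMin ξ (Function.update s k a) i := by
      refine le_iInf₂ fun l _ => ?_
      by_cases hl : l = k
      · subst hl; rwa [Function.update_self]
      · rw [Function.update_of_ne hl]; exact hmin l
    have hcomm : ∀ b, Function.update (Function.update s i b) k a =
        Function.update (Function.update s k a) i b := fun b => Function.update_comm hik _ _ _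
    simp only [hcomm, coordAvg, othersMin_update, Function.update_idem, Function.update_self]
    exact branchAvg_branchAvg κ hξ hA hle (s i) (hup _ i)

end Invariance

/-! ### One iteration of the algorithm -/

section Step

variable {E : Type*} [MeasurableSpace E] (κ : Kernel E E) [IsMarkovKernel κ] {n : ℕ}
  [n.AtLeastTwo] {ξ : E → ℝ} {A : Set E} {zB : ℝ} {𝒯 : Set ℕ} (hξ : Measurable ξ)
  (hA : MeasurableSet A)

lemma lintegral_othersKernel (i : Fin n) (g : Fin n → ℝ≥0∞) :
    ∫⁻ j, g j ∂othersKernel n i =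
      ((n - 1 : ℕ) : ℝ≥0∞)⁻¹ * ∑ j ∈ Finset.univ.erase i, g j := by
  have h : ∀ j, othersKernel n i {j} =
      if j ∈ Finset.univ.erase i then ((n - 1 : ℕ) : ℝ≥0∞)⁻¹ else 0 := by
    intro j
    change (PMF.uniformOfFinset _ (others_nonempty i)).toMeasure {j} = _
    rw [PMF.toMeasure_apply_singleton _ _ (measurableSet_singleton j), PMF.uniformOfFinset_apply,
      Finset.card_erase_of_mem (Finset.mem_univ i), Finset.card_fin]
    congr
  rw [lintegral_fintype, Finset.mul_sum]
  simp_rw [h, mul_ite, mul_zero]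
  rw [Finset.sum_ite_mem, Finset.univ_inter]
  exact Finset.sum_congr rfl fun j _ => mul_comm _ _

lemma lintegral_stepKernel {s : Fin n → ℕ → E} {k : Fin n} (hs : s ∈ killSet E ξ zB k)
    {h : (Fin n → ℕ → E) → ℝ≥0∞} (hh : Measurable h) :
    ∫⁻ s', h s' ∂stepKernel κ hξ hA zB 𝒯 n s =
      ((n - 1 : ℕ) : ℝ≥0∞)⁻¹ *
        ∑ j ∈ Finset.univ.erase k, replaceAvg κ ξ A zB 𝒯 k j h s := by
  obtain ⟨rfl, hns⟩ : killed ξ s = k ∧ s ∉ allReached E n ξ zB := hs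
  classical
  rw [stepKernel, Kernel.lintegral_piecewise, if_neg hns, Kernel.lintegral_comp _ _ _ hh,
    Kernel.lintegral_id_prod hh.lintegral_kernel, Kernel.comap_apply, lintegral_othersKernel]
  congr 1
  refine Finset.sum_congr rfl fun j _ => ?_
  have hu := measurable_update (n := n) hξ hA zB 𝒯
  have hhu : Measurable fun p : ((Fin n → ℕ → E) × Fin n) × (ℕ → E) =>
      h (update ξ A zB 𝒯 p.1.1 p.1.2 p.2) := hh.comp hu
  rw [resampleKernel, Kernel.lintegral_map _ hu _ hh, Kernel.lintegral_id_prod hhu,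
    Kernel.comap_apply]
  rfl

include hξ in
lemma setLIntegral_compl_allReached (η : Measure (Fin n → ℕ → E))
    (h : (Fin n → ℕ → E) → ℝ≥0∞) :
    ∫⁻ s in (allReached E n ξ zB)ᶜ, h s ∂η = ∑ k, ∫⁻ s in killSet E ξ zB k, h s ∂η := by
  have hU : (allReached E n ξ zB)ᶜ = ⋃ k, killSet E ξ zB k := by
    ext s; simp [killSet]
  rw [hU, lintegral_iUnion (fun k => measurableSet_killSet hξ k) _ h, tsum_fintype]
  intro k l hkl
  refine Set.disjoint_left.2 fun s hs hs' => hkl ?_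
  exact hs.1.symm.trans hs'.1

/-- The law of the replicas after one iteration, on the event that this iteration is performed. -/
def nextLaw (zB : ℝ) (𝒯 : Set ℕ) (η : Measure (Fin n → ℕ → E)) : Measure (Fin n → ℕ → E) :=
  (η.restrict (allReached E n ξ zB)ᶜ).bind (stepKernel κ hξ hA zB 𝒯 n)

lemma lintegral_nextLaw (η : Measure (Fin n → ℕ → E)) {h : (Fin n → ℕ → E) → ℝ≥0∞}
    (hh : Measurable h) :
    ∫⁻ s, h s ∂nextLaw κ hξ hA zB 𝒯 η =
      ∫⁻ s in (allReached E n ξ zB)ᶜ, ∫⁻ s', h s' ∂stepKernel κ hξ hA zB 𝒯 n s ∂η :=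
  Measure.lintegral_bind (Kernel.aemeasurable _) hh.aemeasurable

lemma nextLaw_univ_le (η : Measure (Fin n → ℕ → E)) :
    nextLaw κ hξ hA zB 𝒯 η Set.univ ≤ η Set.univ := by
  rw [← lintegral_one, lintegral_nextLaw κ hξ hA η measurable_const]
  simpa using measure_mono (Set.subset_univ _)

lemma lintegral_nextLaw_eq_sum (η : Measure (Fin n → ℕ → E)) {h : (Fin n → ℕ → E) → ℝ≥0∞}
    (hh : Measurable h) :
    ∫⁻ s, h s ∂nextLaw κ hξ hA zB 𝒯 η =
      ∑ k, ((n - 1 : ℕ) : ℝ≥0∞)⁻¹ * ∑ j ∈ Finset.univ.erase k,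
        ∫⁻ s in killSet E ξ zB k, replaceAvg κ ξ A zB 𝒯 k j h s ∂η := by
  rw [lintegral_nextLaw κ hξ hA η hh, setLIntegral_compl_allReached hξ]
  refine Finset.sum_congr rfl fun k _ => ?_
  have hm := fun j => measurable_replaceAvg (zB := zB) (𝒯 := 𝒯) κ hξ hA k j hh
  rw [setLIntegral_congr_fun (measurableSet_killSet hξ k)
    (fun s hs => lintegral_stepKernel κ hξ hA hs hh),
    lintegral_const_mul _ (Finset.measurable_sum _ fun j _ => hm j),
    lintegral_finsetSum _ fun j _ => hm j]

variable {κ}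

include hξ in
lemma BranchInvariant.restrict_killSet {η : Measure (Fin n → ℕ → E)}
    (hη : BranchInvariant κ ξ A zB 𝒯 η)
    (hstopped : ∀ᵐ s ∂η, ∀ i, stopPath ξ A zB (s i) = s i) (k : Fin n) :
    BranchInvariant κ ξ A zB 𝒯 (η.restrict (killSet E ξ zB k)) :=
  hη.restrict hstopped (measurableSet_killSet hξ k) fun _ _ y hs =>
    update_branch_mem_killSet_iff hs y

variable [TopologicalSpace E] [PolishSpace E] [BorelSpace E]

/-- The iteration is split by killed index and donor. Each restriction of `η` to a killed index
remains invariant because branching does not change that index. -/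
lemma BranchInvariant.nextLaw {η : Measure (Fin n → ℕ → E)}
    (hη : BranchInvariant κ ξ A zB 𝒯 η) :
    BranchInvariant κ ξ A zB 𝒯 (nextLaw κ hξ hA zB 𝒯 η) := by
  intro i h hh
  have hstopped := hη.ae_stopPath hξ hA
  rw [lintegral_nextLaw_eq_sum κ hξ hA η hh,
    lintegral_nextLaw_eq_sum κ hξ hA η (measurable_coordAvg κ hξ hA i hh)]
  refine Finset.sum_congr rfl fun k _ => ?_
  congr 1
  refine Finset.sum_congr rfl fun j hj => ?_
  exact (hη.restrict_killSet hξ hstopped k).lintegral_replaceAvg_coordAvg hξ hA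
    (ae_restrict_of_ae hstopped) (Finset.ne_of_mem_erase hj)
    (ae_restrict_mem (measurableSet_killSet hξ k)) i hh

/-- The indicator of the paths which exceed the level `z_B`. -/
def reach (ξ : E → ℝ) (zB : ℝ) (x : ℕ → E) : ℝ≥0∞ :=
  {x : ℕ → E | (zB : EReal) < maxLevel ξ x}.indicator 1 x

omit [MeasurableSpace E] [BorelSpace E] [PolishSpace E] [TopologicalSpace E] in
lemma reach_of_lt {x : ℕ → E} (h : (zB : EReal) < maxLevel ξ x) : reach ξ zB x = 1 :=
  Set.indicator_of_mem (s := {x : ℕ → E | (zB : EReal) < maxLevel ξ x}) h _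

omit [MeasurableSpace E] [BorelSpace E] [PolishSpace E] [TopologicalSpace E] in
lemma reach_of_le {x : ℕ → E} (h : maxLevel ξ x ≤ zB) : reach ξ zB x = 0 :=
  Set.indicator_of_notMem (s := {x : ℕ → E | (zB : EReal) < maxLevel ξ x}) (not_lt.2 h) _

omit [BorelSpace E] [PolishSpace E] [TopologicalSpace E] in
include hξ in
lemma measurable_reach : Measurable (reach ξ zB) :=
  measurable_one.indicator (measurableSet_lt measurable_const (measurable_maxLevel hξ))

/-- The proportion of the replicas which exceed the level `z_B`. -/
def reachRatio (ξ : E → ℝ) (zB : ℝ) (s : Fin n → ℕ → E) : ℝ≥0∞ :=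
  (n : ℝ≥0∞)⁻¹ * ∑ i, reach ξ zB (s i)

omit [BorelSpace E] [PolishSpace E] [TopologicalSpace E] [n.AtLeastTwo] in
include hξ in
lemma measurable_sum_reach :
    Measurable fun s : Fin n → ℕ → E => ∑ i, reach ξ zB (s i) :=
  Finset.measurable_sum _ fun i _ => (measurable_reach hξ).comp (measurable_pi_apply i)

omit [MeasurableSpace E] [BorelSpace E] [PolishSpace E] [TopologicalSpace E] [n.AtLeastTwo] in
lemma sum_reach_le (s : Fin n → ℕ → E) : ∑ i, reach ξ zB (s i) ≤ n := by
  refine (Finset.sum_le_card_nsmul _ _ 1 fun i _ => ?_).trans (by simp)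
  exact Set.indicator_le_self' (fun _ _ => zero_le) _

omit [MeasurableSpace E] [BorelSpace E] [PolishSpace E] [TopologicalSpace E] [n.AtLeastTwo] in
lemma reachRatio_le_one (s : Fin n → ℕ → E) : reachRatio ξ zB s ≤ 1 := by
  rw [reachRatio, mul_comm, ← div_eq_mul_inv]
  exact ENNReal.div_le_of_le_mul (by simpa using sum_reach_le s)

omit [MeasurableSpace E] [BorelSpace E] [PolishSpace E] [TopologicalSpace E] in
lemma reachRatio_of_mem {s : Fin n → ℕ → E} (hs : s ∈ allReached E n ξ zB) :
    reachRatio ξ zB s = 1 := by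
  have h : ∀ i, reach ξ zB (s i) = 1 := fun i =>
    reach_of_lt (mem_allReached_iff.1 hs i)
  have hn : (n : ℝ≥0∞) ≠ 0 := by exact_mod_cast NeZero.ne n
  simp [reachRatio, h, ENNReal.inv_mul_cancel hn]

/-- The factor `1 - 1 / n` by which the weight of the replicas is multiplied at each iteration. -/
def weight (n : ℕ) : ℝ≥0∞ := ENNReal.ofReal (1 - 1 / (n : ℝ))

omit [n.AtLeastTwo] in
lemma weight_mul [NeZero n] : weight n * n = ((n - 1 : ℕ) : ℝ≥0∞) := by
  have hn : (1 : ℝ) ≤ n := by exact_mod_cast NeZero.one_le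
  have h0 : (0 : ℝ) ≤ 1 - 1 / (n : ℝ) := by
    rw [sub_nonneg, div_le_one (by linarith)]; exact hn
  rw [weight, ← ENNReal.ofReal_natCast, ← ENNReal.ofReal_mul h0, ← ENNReal.ofReal_natCast,
    Nat.cast_sub NeZero.one_le]
  congr 1
  field_simp
  simp

lemma weight_mul_inv_mul : weight n * ((n - 1 : ℕ) : ℝ≥0∞)⁻¹ * n = 1 := by
  have h : n - 1 ≠ 0 := by have := Nat.AtLeastTwo.prop (n := n); omega
  rw [mul_right_comm, weight_mul]
  exact ENNReal.mul_inv_cancel (by exact_mod_cast h) (ENNReal.natCast_ne_top _)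

omit [BorelSpace E] [PolishSpace E] [TopologicalSpace E] in
include hξ in
-- The killed replica contributes nothing, so the replacement adds exactly the contribution of the
-- copy. Its mean is that of replica `j`, by invariance in coordinate `j`, whose branching level is
-- the killed one.
lemma BranchInvariant.lintegral_replaceAvg_reach {η : Measure (Fin n → ℕ → E)}
    (hη : BranchInvariant κ ξ A zB 𝒯 η) {k j : Fin n} (hjk : j ≠ k)
    (hk : ∀ᵐ s ∂η, s ∈ killSet E ξ zB k) :
    ∫⁻ s, replaceAvg κ ξ A zB 𝒯 k j (fun s => ∑ i, reach ξ zB (s i)) s ∂η =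
      ∫⁻ s, ∑ i, reach ξ zB (s i) ∂η + ∫⁻ s, reach ξ zB (s j) ∂η := by
  have hrj : Measurable fun s : Fin n → ℕ → E => reach ξ zB (s j) :=
    (measurable_reach hξ).comp (measurable_pi_apply j)
  rw [← hη j _ hrj, ← lintegral_add_left (measurable_sum_reach hξ)]
  refine lintegral_congr_ae ?_
  filter_upwards [hk] with s hs
  obtain ⟨h1, -, h3⟩ := mem_killSet_iff.1 hs
  have hk0 : reach ξ zB (s k) = 0 := reach_of_le h3
  have hsum : ∀ a, ∑ i, reach ξ zB (Function.update s k a i) =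
      ∑ i, reach ξ zB (s i) + reach ξ zB a := by
    intro a
    rw [← Finset.add_sum_erase _ _ (Finset.mem_univ k), Function.update_self,
      ← Finset.add_sum_erase _ (fun i => reach ξ zB (s i)) (Finset.mem_univ k), hk0, zero_add,
      add_comm]
    congr 1
    exact Finset.sum_congr rfl fun i hi => by
      rw [Function.update_of_ne (Finset.ne_of_mem_erase hi)]
  simp only [replaceAvg, coordAvg, hsum, Function.update_self, othersMin_eq h1 hjk]
  rw [branchAvg, lintegral_add_left measurable_const]
  simp [branchAvg]

/-- On the event that an iteration is performed, the weighted proportion of the replicas which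
exceed the level `z_B` is the same on average before and after this iteration. -/
lemma BranchInvariant.weight_mul_lintegral_nextLaw {η : Measure (Fin n → ℕ → E)}
    (hη : BranchInvariant κ ξ A zB 𝒯 η) :
    weight n * ∫⁻ s, reachRatio ξ zB s ∂AMS.nextLaw κ hξ hA zB 𝒯 η =
      ∫⁻ s in (allReached E n ξ zB)ᶜ, reachRatio ξ zB s ∂η := by
  have hstopped := hη.ae_stopPath hξ hA
  simp only [reachRatio]
  rw [lintegral_const_mul _ (measurable_sum_reach hξ),
    lintegral_const_mul _ (measurable_sum_reach hξ),
    mul_left_comm]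
  congr 1
  rw [lintegral_nextLaw_eq_sum κ hξ hA η (measurable_sum_reach hξ),
    setLIntegral_compl_allReached hξ, Finset.mul_sum]
  refine Finset.sum_congr rfl fun k _ => ?_
  have hmem : ∀ᵐ s ∂η.restrict (killSet E ξ zB k), s ∈ killSet E ξ zB k :=
    ae_restrict_mem (measurableSet_killSet hξ k)
  set I := ∫⁻ s in killSet E ξ zB k, ∑ i, reach ξ zB (s i) ∂η with hI
  -- The donors' contributions add up to the full sum, as the killed replica is below `z_B`.
  have hsum : ∑ j ∈ Finset.univ.erase k, ∫⁻ s in killSet E ξ zB k, reach ξ zB (s j) ∂η = I := by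
    have hm : ∀ i, Measurable fun s : Fin n → ℕ → E => reach ξ zB (s i) := fun i =>
      (measurable_reach hξ).comp (measurable_pi_apply i)
    rw [hI, lintegral_finsetSum _ fun i _ => hm i,
      ← Finset.add_sum_erase _ _ (Finset.mem_univ k)]
    have h0 : ∫⁻ s in killSet E ξ zB k, reach ξ zB (s k) ∂η = 0 := by
      rw [lintegral_congr_ae (g := fun _ => 0), lintegral_zero]
      filter_upwards [hmem] with s hs
      exact reach_of_le (mem_killSet_iff.1 hs).2.2
    rw [h0, zero_add]
  rw [Finset.sum_congr rfl fun j hj =>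
    (hη.restrict_killSet hξ hstopped k).lintegral_replaceAvg_reach hξ (Finset.ne_of_mem_erase hj) hmem, Finset.sum_add_distrib, hsum, Finset.sum_const,
    Finset.card_erase_of_mem (Finset.mem_univ k), Finset.card_fin, nsmul_eq_mul]
  have hn : ((n - 1 : ℕ) : ℝ≥0∞) * I + I = n * I := by
    rw [← add_one_mul]
    congr 1
    have := NeZero.one_le (n := n)
    exact_mod_cast Nat.sub_add_cancel this
  rw [hn, ← mul_assoc, ← mul_assoc, weight_mul_inv_mul, one_mul]

end Step

/-! ### The initial replicas -/

section Initial

variable {E : Type*} {ξ : E → ℝ} {A : Set E} {zB : ℝ} {𝒯 : Set ℕ}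

/-- Since `ξ ≤ z_B` on `A`, a path cannot enter `A` and exceed `z_B` at the same time, which makes
the inequality of times strict. -/
lemma lt_maxLevel_stopPath_iff (hAB : ∀ x ∈ A, ξ x ≤ zB) (x : ℕ → E) :
    (zB : EReal) < maxLevel ξ (stopPath ξ A zB x) ↔ levelTime ξ zB x < hitTime A x := by
  constructor
  · intro h
    obtain ⟨k, hk⟩ := lt_iSup_iff.1 h
    have hj : ∃ j : ℕ, (j : ℕ∞) = min (k : ℕ∞) (min (hitTime A x) (levelTime ξ zB x)) :=
      ENat.ne_top_iff_exists.mp (ne_top_of_le_ne_top (ENat.natCast_ne_top k) (min_le_left _ _))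
    obtain ⟨j, hj⟩ := hj
    rw [stopPath, stopAt, ← hj, ENat.toNat_natCast] at hk
    have hjhit : (j : ℕ∞) ≤ hitTime A x := hj.le.trans ((min_le_right _ _).trans (min_le_left _ _))
    refine lt_of_le_of_lt (levelTime_le_iff.2 ⟨j, le_rfl, hk⟩) (lt_of_le_of_ne hjhit fun he => ?_)
    obtain ⟨i, hij, hi⟩ := (firstTime_le_iff _ j).1 he.ge
    have hji : (j : ℕ∞) ≤ i := hjhit.trans (iInf₂_le i hi)
    obtain rfl : i = j := le_antisymm hij (by exact_mod_cast hji)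
    exact absurd hk (not_lt.2 (by exact_mod_cast hAB _ hi))
  · intro h
    obtain ⟨m, hm⟩ := ENat.ne_top_iff_exists.mp (h.trans_le le_top).ne
    obtain ⟨k, hkm, hk⟩ := levelTime_le_iff.1 hm.ge
    refine lt_maxLevel (k := k) ?_
    rwa [stopPath_apply]
    rw [← exitTime_eq, min_eq_right h.le, ← hm]
    exact_mod_cast hkm

lemma lintegral_pi_update {ι Ω : Type*} [Fintype ι] [DecidableEq ι] [MeasurableSpace Ω]
    (ν : Measure Ω) [IsProbabilityMeasure ν] (i : ι) {h : (ι → Ω) → ℝ≥0∞} (hh : Measurable h) :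
    ∫⁻ s, ∫⁻ b, h (Function.update s i b) ∂ν ∂Measure.pi (fun _ : ι => ν) =
      ∫⁻ s, h s ∂Measure.pi (fun _ : ι => ν) := by
  have hm : Measurable fun s : ι → Ω => ∫⁻ b, h (Function.update s i b) ∂ν :=
    Measurable.lintegral_prod_right' (f := fun p : (ι → Ω) × Ω => h (Function.update p.1 i p.2))
      (hh.comp measurable_update')
  -- Coordinate `i` is integrated out both in `h` and in its average over coordinate `i`; the latter
  -- no longer depends on it, so the results agree.
  have h1 := lmarginal_erase' (μ := fun _ : ι => ν) h hh (Finset.mem_univ i)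
  have h2 := lmarginal_erase' (μ := fun _ : ι => ν) _ hm (Finset.mem_univ i)
  simp only [Function.update_idem, lintegral_const, measure_univ, mul_one] at h2
  rw [← h1] at h2
  simp only [lmarginal_univ] at h2
  by_cases hne : Nonempty (ι → Ω)
  · obtain ⟨x⟩ := hne
    exact congrFun h2 x
  · rw [not_nonempty_iff] at hne
    simp [lintegral_of_isEmpty]

variable [MeasurableSpace E] (κ : Kernel E E) [IsMarkovKernel κ] (μ : Measure E)
  [IsProbabilityMeasure μ] (hξ : Measurable ξ) (hA : MeasurableSet A) (n : ℕ)

include hξ hA in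
-- With the other replicas frozen, the branching level is a constant and replica `i` is an
-- independent stopped chain, to which the strong Markov property applies.
lemma branchInvariant_initialLaw [MeasurableSingletonClass E] :
    BranchInvariant κ ξ A zB 𝒯 (initialLaw κ μ ξ A zB n) := by
  intro i h hh
  have hst := measurable_stopPath hξ hA zB
  have : IsProbabilityMeasure ((chainLaw κ μ).map (stopPath ξ A zB)) :=
    Measure.isProbabilityMeasure_map hst.aemeasurable
  rw [initialLaw, ← lintegral_pi_update _ i (measurable_coordAvg κ hξ hA i hh),
    ← lintegral_pi_update _ i hh]
  refine lintegral_congr fun s => ?_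
  have hup : Measurable fun a => h (Function.update s i a) := hh.comp (_root_.measurable_update s)
  have hbr : Measurable (branchAvg κ ξ A zB 𝒯 (othersMin ξ s i)
      fun a => h (Function.update s i a)) :=
    measurable_branchAvg_param κ hξ hA measurable_const measurable_id (hup.comp measurable_snd)
  simp only [coordAvg, othersMin_update, Function.update_idem, Function.update_self]
  rw [lintegral_map hbr hst, lintegral_map hup hst]
  simp only [branchAvg_stopPath]
  have hus : Measurable fun x => h (Function.update s i (stopPath ξ A zB x)) := hup.comp hst
  rw [chainLaw, Measure.lintegral_bind (Kernel.aemeasurable _) hbr.aemeasurable,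
    Measure.lintegral_bind (Kernel.aemeasurable _) hus.aemeasurable]
  exact lintegral_congr fun x => lintegral_branchAvg κ hξ hA _ x hup

include hξ hA in
lemma lintegral_reachRatio_initialLaw [NeZero n] (hAB : ∀ x ∈ A, ξ x ≤ zB) :
    ∫⁻ s, reachRatio ξ zB s ∂initialLaw κ μ ξ A zB n =
      chainLaw κ μ {x | levelTime ξ zB x < hitTime A x} := by
  have hst := measurable_stopPath hξ hA zB
  have : IsProbabilityMeasure ((chainLaw κ μ).map (stopPath ξ A zB)) :=
    Measure.isProbabilityMeasure_map hst.aemeasurable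
  have hm : ∀ i, Measurable fun s : Fin n → ℕ → E => reach ξ zB (s i) := fun i =>
    (measurable_reach hξ).comp (measurable_pi_apply i)
  have hset : {x | (zB : EReal) < maxLevel ξ (stopPath ξ A zB x)} =
      {x | levelTime ξ zB x < hitTime A x} := by
    ext x; exact lt_maxLevel_stopPath_iff hAB x
  have hone : ∀ i, ∫⁻ s, reach ξ zB (s i) ∂initialLaw κ μ ξ A zB n =
      chainLaw κ μ {x | levelTime ξ zB x < hitTime A x} := by
    intro i
    rw [initialLaw, (measurePreserving_eval
      (fun _ : Fin n => (chainLaw κ μ).map (stopPath ξ A zB)) i).lintegral_comp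
      (measurable_reach hξ), lintegral_map (measurable_reach hξ) hst, ← hset]
    exact lintegral_indicator_one
      (hst (measurableSet_lt measurable_const (measurable_maxLevel hξ)))
  simp only [reachRatio]
  rw [lintegral_const_mul _ (measurable_sum_reach hξ), lintegral_finsetSum _ fun i _ => hm i]
  simp only [hone, Finset.sum_const, Finset.card_univ, Fintype.card_fin, nsmul_eq_mul]
  rw [← mul_assoc, ENNReal.inv_mul_cancel (by exact_mod_cast NeZero.ne n)
    (ENNReal.natCast_ne_top _), one_mul]

end Initial

/-! ### The estimator -/

section Estimator

variable {E : Type*} {n : ℕ} {ξ : E → ℝ} {A : Set E} {zB : ℝ} {𝒯 : Set ℕ}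

/-- The estimator, with values in `ℝ≥0∞`. -/
def weightPow (n : ℕ) (Q : ℕ∞) : ℝ≥0∞ := if Q = ⊤ then 0 else weight n ^ Q.toNat

lemma toReal_weightPow [NeZero n] (Q : ℕ∞) : (weightPow n Q).toReal = estimator n Q := by
  have hn : (1 : ℝ) ≤ n := by exact_mod_cast NeZero.one_le
  have h0 : (0 : ℝ) ≤ 1 - 1 / (n : ℝ) := by
    rw [sub_nonneg, div_le_one (by linarith)]; exact hn
  rw [weightPow, estimator]
  split_ifs
  · rfl
  · rw [ENNReal.toReal_pow, weight, ENNReal.toReal_ofReal h0]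

lemma weight_lt_one [NeZero n] : weight n < 1 := by
  have hn : (0 : ℝ) < n := by exact_mod_cast NeZero.pos n
  rw [weight, ENNReal.ofReal_lt_one]
  have : 0 < 1 / (n : ℝ) := by positivity
  linarith

lemma weightPow_le_one [NeZero n] (Q : ℕ∞) : weightPow n Q ≤ 1 := by
  rw [weightPow]
  split_ifs
  · exact zero_le
  · exact pow_le_one₀ zero_le weight_lt_one.le

lemma weightPow_add_one (Q : ℕ∞) : weightPow n (1 + Q) = weight n * weightPow n Q := by
  cases Q with
  | top => simp [weightPow]
  | coe q =>
    have h : (1 : ℕ∞) + q = ((1 + q : ℕ) : ℕ∞) := by push_cast; rfl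
    rw [h]
    simp only [weightPow, ENat.natCast_ne_top, if_false, ENat.toNat_natCast]
    rw [pow_add, pow_one]

lemma numIter_pathCons_of_mem {s : Fin n → ℕ → E} (hs : s ∈ allReached E n ξ zB)
    (run : ℕ → Fin n → ℕ → E) : numIter ξ zB (pathCons s run) = 0 :=
  le_antisymm (iInf₂_le 0 hs) zero_le

lemma numIter_pathCons_of_notMem {s : Fin n → ℕ → E} (hs : s ∉ allReached E n ξ zB)
    (run : ℕ → Fin n → ℕ → E) : numIter ξ zB (pathCons s run) = 1 + numIter ξ zB run := by
  refine le_antisymm ?_ (le_iInf₂ fun k hk => ?_)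
  · cases hF : numIter ξ zB run with
    | top => simp
    | coe m =>
      obtain ⟨k, hkm, hk⟩ := (firstTime_le_iff _ m).1 hF.le
      refine (iInf₂_le (k + 1) hk).trans ?_
      exact_mod_cast (by omega : k + 1 ≤ 1 + m)
  · cases k with
    | zero => exact absurd hk hs
    | succ k =>
      have : numIter ξ zB run ≤ k := iInf₂_le k hk
      push_cast
      rw [add_comm]
      gcongr

variable [MeasurableSpace E]

lemma measurable_weightPow_numIter (hξ : Measurable ξ) :
    Measurable fun run : ℕ → Fin n → ℕ → E => weightPow n (numIter ξ zB run) := by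
  have h : Measurable fun run : ℕ → Fin n → ℕ → E => numIter ξ zB run :=
    measurable_firstTime fun q => measurable_pi_apply q (measurableSet_allReached hξ zB)
  exact (Measurable.of_discrete (f := weightPow n)).comp h

variable (κ : Kernel E E) [IsMarkovKernel κ] [n.AtLeastTwo] (hξ : Measurable ξ)
  (hA : MeasurableSet A)

/-- The mean value of the estimator for the algorithm started at `s`. -/
def meanEstimator (zB : ℝ) (𝒯 : Set ℕ) (s : Fin n → ℕ → E) : ℝ≥0∞ :=
  ∫⁻ run, weightPow n (numIter ξ zB run) ∂chainKernel (stepKernel κ hξ hA zB 𝒯 n) s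

lemma measurable_meanEstimator :
    Measurable (meanEstimator κ hξ hA zB 𝒯 : (Fin n → ℕ → E) → ℝ≥0∞) :=
  (measurable_weightPow_numIter hξ).lintegral_kernel

lemma meanEstimator_le_one (s : Fin n → ℕ → E) : meanEstimator κ hξ hA zB 𝒯 s ≤ 1 := by
  refine (lintegral_mono fun run => weightPow_le_one (numIter ξ zB run)).trans ?_
  simp

variable [MeasurableSingletonClass E]

lemma meanEstimator_of_mem {s : Fin n → ℕ → E} (hs : s ∈ allReached E n ξ zB) :
    meanEstimator κ hξ hA zB 𝒯 s = 1 := by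
  rw [meanEstimator, lintegral_chainKernel _ _ (measurable_weightPow_numIter hξ)]
  simp [numIter_pathCons_of_mem hs, weightPow]

/-- First-step analysis: one performed iteration adds one to the count, hence a factor `weight n`.
-/
lemma meanEstimator_of_notMem {s : Fin n → ℕ → E} (hs : s ∉ allReached E n ξ zB) :
    meanEstimator κ hξ hA zB 𝒯 s =
      weight n * ∫⁻ s', meanEstimator κ hξ hA zB 𝒯 s' ∂stepKernel κ hξ hA zB 𝒯 n s := by
  rw [meanEstimator, lintegral_chainKernel _ _ (measurable_weightPow_numIter hξ),
    ← lintegral_const_mul _ (measurable_meanEstimator κ hξ hA)]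
  refine lintegral_congr fun s' => ?_
  rw [meanEstimator, ← lintegral_const_mul _ (measurable_weightPow_numIter hξ)]
  simp only [numIter_pathCons_of_notMem hs, weightPow_add_one]

lemma lintegral_meanEstimator (η : Measure (Fin n → ℕ → E)) :
    ∫⁻ s, meanEstimator κ hξ hA zB 𝒯 s ∂η = η (allReached E n ξ zB) +
      weight n * ∫⁻ s, meanEstimator κ hξ hA zB 𝒯 s ∂nextLaw κ hξ hA zB 𝒯 η := by
  have hm := measurableSet_allReached (E := E) (n := n) hξ zB
  rw [← lintegral_add_compl _ hm, setLIntegral_congr_fun hm fun s hs =>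
    meanEstimator_of_mem κ hξ hA hs, setLIntegral_one, setLIntegral_congr_fun hm.compl fun s hs =>
    meanEstimator_of_notMem κ hξ hA hs,
    lintegral_nextLaw _ _ _ _ (measurable_meanEstimator κ hξ hA),
    lintegral_const_mul _ (measurable_meanEstimator κ hξ hA).lintegral_kernel]

end Estimator

/-! ### Comparison of the two recursions -/

section Unbiasedness

variable {E : Type*} [TopologicalSpace E] [PolishSpace E] [MeasurableSpace E] [BorelSpace E]
  {κ : Kernel E E} [IsMarkovKernel κ] {n : ℕ} [n.AtLeastTwo] {ξ : E → ℝ} {A : Set E} {zB : ℝ}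
  {𝒯 : Set ℕ} (hξ : Measurable ξ) (hA : MeasurableSet A)

lemma BranchInvariant.lintegral_reachRatio {η : Measure (Fin n → ℕ → E)}
    (hη : BranchInvariant κ ξ A zB 𝒯 η) :
    ∫⁻ s, reachRatio ξ zB s ∂η = η (allReached E n ξ zB) +
      weight n * ∫⁻ s, reachRatio ξ zB s ∂AMS.nextLaw κ hξ hA zB 𝒯 η := by
  have hm := measurableSet_allReached (E := E) (n := n) hξ zB
  rw [hη.weight_mul_lintegral_nextLaw hξ hA, ← lintegral_add_compl _ hm,
    setLIntegral_congr_fun hm fun s hs => reachRatio_of_mem hs, setLIntegral_one]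

/-- The mean of the estimator and the mean proportion of the replicas which reach `z_B` satisfy the
same recursion, so that they differ by at most the weight after `q` iterations. -/
lemma BranchInvariant.meanEstimator_reachRatio_le (q : ℕ) {η : Measure (Fin n → ℕ → E)}
    (hη : BranchInvariant κ ξ A zB 𝒯 η) (hη1 : η Set.univ ≤ 1) :
    ∫⁻ s, meanEstimator κ hξ hA zB 𝒯 s ∂η ≤ ∫⁻ s, reachRatio ξ zB s ∂η + weight n ^ q ∧
      ∫⁻ s, reachRatio ξ zB s ∂η ≤ ∫⁻ s, meanEstimator κ hξ hA zB 𝒯 s ∂η + weight n ^ q := by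
  induction q generalizing η with
  | zero =>
    have h1 : ∀ f : (Fin n → ℕ → E) → ℝ≥0∞, (∀ s, f s ≤ 1) → ∫⁻ s, f s ∂η ≤ 1 := fun f hf =>
      ((lintegral_mono hf).trans (by simp)).trans hη1
    rw [pow_zero]
    exact ⟨(h1 _ (meanEstimator_le_one κ hξ hA)).trans le_add_self,
      (h1 _ reachRatio_le_one).trans le_add_self⟩
  | succ q ih =>
    -- The law after one iteration is still invariant with mass at most one; the recursion
    -- multiplies its gap by `weight n`.
    obtain ⟨h1, h2⟩ := ih (hη.nextLaw hξ hA) ((nextLaw_univ_le κ hξ hA η).trans hη1)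
    rw [lintegral_meanEstimator, hη.lintegral_reachRatio hξ hA, pow_succ', add_assoc, add_assoc,
      ← mul_add, ← mul_add]
    exact ⟨by gcongr, by gcongr⟩

/-- The gap `weight n ^ q` tends to zero. Runs that never terminate need no separate treatment, the
estimator being `0` on them. -/
lemma BranchInvariant.lintegral_meanEstimator_eq {η : Measure (Fin n → ℕ → E)}
    (hη : BranchInvariant κ ξ A zB 𝒯 η) (hη1 : η Set.univ ≤ 1) :
    ∫⁻ s, meanEstimator κ hξ hA zB 𝒯 s ∂η = ∫⁻ s, reachRatio ξ zB s ∂η := by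
  have hlim : ∀ a : ℝ≥0∞, Filter.Tendsto (fun q => a + weight n ^ q) Filter.atTop (nhds a) := by
    intro a
    simpa using tendsto_const_nhds.add
      (ENNReal.tendsto_pow_atTop_nhds_zero_of_lt_one (weight_lt_one (n := n)))
  exact le_antisymm
    (ge_of_tendsto' (hlim _) fun q => (hη.meanEstimator_reachRatio_le hξ hA q hη1).1)
    (ge_of_tendsto' (hlim _) fun q => (hη.meanEstimator_reachRatio_le hξ hA q hη1).2)

lemma lintegral_weightPow_algorithmLaw (κ : Kernel E E) [IsMarkovKernel κ] (μ : Measure E)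
    [IsProbabilityMeasure μ] (hAB : ∀ x ∈ A, ξ x ≤ zB) :
    ∫⁻ run, weightPow n (numIter ξ zB run) ∂algorithmLaw κ μ hξ hA zB 𝒯 n =
      chainLaw κ μ {x | levelTime ξ zB x < hitTime A x} := by
  have hst := measurable_stopPath hξ hA zB
  have h1 : IsProbabilityMeasure ((chainLaw κ μ).map (stopPath ξ A zB)) :=
    Measure.isProbabilityMeasure_map hst.aemeasurable
  have h2 : initialLaw κ μ ξ A zB n Set.univ = 1 := by
    rw [initialLaw]; exact measure_univ
  rw [algorithmLaw, chainLaw, Measure.lintegral_bind (Kernel.aemeasurable _)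
    (measurable_weightPow_numIter hξ).aemeasurable,
    ← lintegral_reachRatio_initialLaw κ μ hξ hA n hAB]
  exact (branchInvariant_initialLaw κ μ hξ hA n).lintegral_meanEstimator_eq hξ hA h2.le

end Unbiasedness

end AMS

end

theorem mainTheorem2 {E : Type*} [TopologicalSpace E] [PolishSpace E] [MeasurableSpace E]
    [BorelSpace E] (κ : Kernel E E) [IsMarkovKernel κ] (μ : Measure E) [IsProbabilityMeasure μ]
    (ξ : E → ℝ) (hξ : Continuous ξ) (A : Set E) (hA : MeasurableSet A) (zB : ℝ)
    (hAB : ∀ x ∈ A, ξ x ≤ zB) (𝒯 : Set ℕ) (n : ℕ) [n.AtLeastTwo] :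
    Integrable (fun run => AMS.estimator n (AMS.numIter ξ zB run))
        (AMS.algorithmLaw κ μ hξ.measurable hA zB 𝒯 n) ∧
      ∫ run, AMS.estimator n (AMS.numIter ξ zB run)
          ∂(AMS.algorithmLaw κ μ hξ.measurable hA zB 𝒯 n) =
        (AMS.chainLaw κ μ).real {x | AMS.levelTime ξ zB x < AMS.hitTime A x} := by
  have hm := AMS.measurable_weightPow_numIter (n := n) (zB := zB) hξ.measurable
  have hint := AMS.lintegral_weightPow_algorithmLaw (n := n) (𝒯 := 𝒯) hξ.measurable hA κ μ hAB
  -- The real estimator is the `toReal` of an extended nonnegative one bounded by `1`, so the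
  -- identity of lower integrals gives both claims.
  simp only [← AMS.toReal_weightPow]
  refine ⟨integrable_toReal_of_lintegral_ne_top hm.aemeasurable ?_, ?_⟩
  · rw [hint]
    exact measure_ne_top _ _
  · rw [integral_toReal hm.aemeasurable
      (Filter.Eventually.of_forall fun run =>
        (AMS.weightPow_le_one _).trans_lt ENNReal.one_lt_top), hint, Measure.real]
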